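/- Let $\mathbf X=(X_1,X_2,\dots)$, $\mathbf Y=(Y_1,Y_2,\dots)$ and $\mathbf Z=(Z_1,Z_2,\dots)$ be three independent sequences of random variables on a common probability space, each of which is a sequence of independent random variables whose $j$-th term is Poisson with parameter $1/j$, for every $j\ge 1$. For a sequence $\mathbf W=(W_1,W_2,\dots)$ of nonnegative integers let $$\mathscr L(\mathbf W)=\Big\{\sum_{j\ge 1} j w_j : w_j\in\mathbb Z,\ 0\le w_j\le W_j \text{ for all } j\ge 1,\ w_j=0 \text{ for all but finitely many } j\Big\}.$$ Then, almost surely, the set $\mathscr L(\mathbf X)\cap\mathscr L(\mathbf Y)\cap\mathscr L(\mathbf Z)$ is infinite. -/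

import Mathlib

open MeasureTheory ProbabilityTheory
open scoped NNReal

/-- The sumset `ℒ(X) = {∑_{j ≥ 1} j x_j : 0 ≤ x_j ≤ X_j}` of a sequence `X = (X₁, X₂, …)` of
natural numbers. The sums are finite natural numbers, that is, all but finitely many of the
`x_j` vanish. -/
def sumsetL (X : ℕ+ → ℕ) : Set ℕ :=
  {n | ∃ x : ℕ+ →₀ ℕ, (∀ j, x j ≤ X j) ∧ n = x.sum fun j a => (j : ℕ) * a}

/-- `X = (X₁, X₂, …)` is a sequence of independent Poisson random variables, where `X_j` has
parameter `1 / j`. -/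
structure IsPoissonSeq {Ω : Type*} [MeasurableSpace Ω] (X : ℕ+ → Ω → ℕ) (μ : Measure Ω) :
    Prop where
  hasLaw : ∀ j : ℕ+, HasLaw (X j) (poissonMeasure (1 / ((j : ℕ) : ℝ≥0))) μ
  indep : iIndepFun X μ

/-! Only 0/1 coefficients are needed, so each sequence matters through its set of nonvanishing
indices, which contains `j` independently with probability `hitProb j`, about `1 / j`. It suffices
that, for some `c > 0`, beyond every `k` there is a block of indices on which the three random sets
have a common nonempty subset sum with probability at least `c` (`exists_missProb_Ioc_le`). Disjoint
blocks are independent, so the probabilities of failure multiply and tend to zero, and a common sum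
built from indices beyond `k` exceeds `k`.

For such a block put `K = k * 2 ^ (50 * k)` and let `A`, `B`, `C` be the random subsets of `(k, K]`.
With subset sums `a`, `b`, `c`, the pairs `(a - c, b - c)` fill a positive proportion of `(ℤ/K)²`
with probability at least 1/2. Indeed Cauchy–Schwarz and Plancherel give at least `K² / energy`
pairs (`sq_le_card_sumDiffs_mul_energy`), where the energy sums products of squared characteristic
functions at `r`, `s`, `r + s`.

At a frequency at distance about `2 ^ d` from 0, the mean of one squared characteristic function is
only of order `2 ^ (-d / 2)`, while convergence of the double sum needs an exponent above 2/3. This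
mean is inflated by atypically sparse sets. A typical set has about `d * log 2` elements in the top
`d` dyadic blocks, and restricting to sets with at least `(17 / 25) * d - C` of them improves the
decay to `2 ^ (-17 * d / 25)` (`expect_isTypical_mul_cosProd_le`). The argument closes because `2/3
< 17/25 < log 2`.

Finally, one further element per set, taken from `(K, 61 * K]`, turns prescribed differences into
equal sums. Positive density of the differences makes this happen with probability bounded below
(`card_sumDiffs_mul_le`, `expect₃_not_hasCommonSum_union_le`). -/

/-! ### Hit probabilities and finite random sets -/

/-- The probability that a Poisson variable with parameter `1 / j` is nonzero. -/
noncomputable def hitProb (j : ℕ) : ℝ := 1 - Real.exp (-(1 / (j : ℝ)))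

lemma one_sub_hitProb (j : ℕ) : 1 - hitProb j = Real.exp (-(1 / (j : ℝ))) := by
  simp [hitProb]

lemma hitProb_nonneg (j : ℕ) : 0 ≤ hitProb j := by
  have : Real.exp (-(1 / (j : ℝ))) ≤ 1 := Real.exp_le_one_iff.2 (by simp)
  simp only [hitProb]; linarith

lemma hitProb_le_one (j : ℕ) : hitProb j ≤ 1 := by
  have := Real.exp_pos (-(1 / (j : ℝ)))
  simp only [hitProb]; linarith

lemma hitProb_le (j : ℕ) : hitProb j ≤ 1 / j := by
  have := Real.add_one_le_exp (-(1 / (j : ℝ)))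
  simp only [hitProb]; linarith

lemma le_hitProb {j : ℕ} (hj : 0 < j) : 1 / ((j : ℝ) + 1) ≤ hitProb j := by
  have hj' : (0 : ℝ) < j := by exact_mod_cast hj
  have h1 := Real.add_one_le_exp (1 / (j : ℝ))
  have h2 : Real.exp (-(1 / (j : ℝ))) ≤ (1 / (j : ℝ) + 1)⁻¹ := by
    rw [Real.exp_neg]
    exact inv_anti₀ (by positivity) h1
  have h3 : (1 / (j : ℝ) + 1)⁻¹ = 1 - 1 / ((j : ℝ) + 1) := by
    field_simp
    ring
  simp only [hitProb]; linarith

lemma hitProb_anti {i j : ℕ} (hi : 0 < i) (hij : i ≤ j) : hitProb j ≤ hitProb i := by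
  have : (1 : ℝ) / j ≤ 1 / i := one_div_le_one_div_of_le (by exact_mod_cast hi)
    (by exact_mod_cast hij)
  have := Real.exp_le_exp.2 (neg_le_neg this)
  simp only [hitProb]; linarith

/-- The probability that the random set, which contains each `j ∈ I` independently with
probability `hitProb j`, equals `A`. -/
noncomputable def setWeight (I A : Finset ℕ) : ℝ :=
  (∏ j ∈ A, hitProb j) * ∏ j ∈ I \ A, (1 - hitProb j)

/-- The expectation of `f` over the random subset of `I` with law `setWeight I`. -/
noncomputable def expect (I : Finset ℕ) (f : Finset ℕ → ℝ) : ℝ :=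
  ∑ A ∈ I.powerset, setWeight I A * f A

lemma setWeight_nonneg (I A : Finset ℕ) : 0 ≤ setWeight I A :=
  mul_nonneg (Finset.prod_nonneg fun j _ => hitProb_nonneg j)
    (Finset.prod_nonneg fun j _ => sub_nonneg.2 (hitProb_le_one j))

/-- Independence of the memberships: expanding the product of binomials over `I` lists the subsets
`A` with their weights. -/
lemma expect_prod (I : Finset ℕ) (u : ℕ → ℝ) :
    expect I (fun A => ∏ j ∈ A, u j) = ∏ j ∈ I, (1 + hitProb j * (u j - 1)) := by
  have h : ∀ j, 1 + hitProb j * (u j - 1) = hitProb j * u j + (1 - hitProb j) := by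
    intro j; ring
  simp only [h, Finset.prod_add, expect, setWeight, Finset.prod_mul_distrib]
  exact Finset.sum_congr rfl fun A _ => by ring

lemma sum_setWeight (I : Finset ℕ) : ∑ A ∈ I.powerset, setWeight I A = 1 := by
  have := expect_prod I (fun _ => 1)
  simpa [expect] using this

lemma expect_const (I : Finset ℕ) (c : ℝ) : expect I (fun _ => c) = c := by
  simp [expect, ← Finset.sum_mul, sum_setWeight]

lemma expect_mono {I : Finset ℕ} {f g : Finset ℕ → ℝ} (h : ∀ A ⊆ I, f A ≤ g A) :
    expect I f ≤ expect I g :=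
  Finset.sum_le_sum fun A hA =>
    mul_le_mul_of_nonneg_left (h A (Finset.mem_powerset.1 hA)) (setWeight_nonneg I A)

lemma expect_congr {I : Finset ℕ} {f g : Finset ℕ → ℝ} (h : ∀ A ⊆ I, f A = g A) :
    expect I f = expect I g :=
  Finset.sum_congr rfl fun A hA => by rw [h A (Finset.mem_powerset.1 hA)]

lemma expect_nonneg {I : Finset ℕ} {f : Finset ℕ → ℝ} (h : ∀ A ⊆ I, 0 ≤ f A) :
    0 ≤ expect I f := by
  simpa [expect_const] using expect_mono (f := fun _ => 0) h

lemma expect_add (I : Finset ℕ) (f g : Finset ℕ → ℝ) :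
    expect I (fun A => f A + g A) = expect I f + expect I g := by
  simp [expect, mul_add, Finset.sum_add_distrib]

lemma expect_const_mul (I : Finset ℕ) (c : ℝ) (f : Finset ℕ → ℝ) :
    expect I (fun A => c * f A) = c * expect I f := by
  simp only [expect, Finset.mul_sum]
  exact Finset.sum_congr rfl fun A _ => by ring

lemma expect_mul_const (I : Finset ℕ) (c : ℝ) (f : Finset ℕ → ℝ) :
    expect I (fun A => f A * c) = expect I f * c := by
  simp only [mul_comm _ c, expect_const_mul]

lemma expect_sum {ι : Type*} (s : Finset ι) (I : Finset ℕ) (f : ι → Finset ℕ → ℝ) :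
    expect I (fun A => ∑ i ∈ s, f i A) = ∑ i ∈ s, expect I (f i) := by
  simp only [expect, Finset.mul_sum]
  rw [Finset.sum_comm]

lemma expect_comm (I J : Finset ℕ) (f : Finset ℕ → Finset ℕ → ℝ) :
    expect I (fun A => expect J (fun B => f A B)) =
      expect J (fun B => expect I (fun A => f A B)) := by
  simp only [expect, Finset.mul_sum]
  rw [Finset.sum_comm]
  exact Finset.sum_congr rfl fun A _ => Finset.sum_congr rfl fun B _ => by ring

lemma setWeight_union {I J A B : Finset ℕ} (hIJ : Disjoint I J) (hA : A ⊆ I) (hB : B ⊆ J) :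
    setWeight (I ∪ J) (A ∪ B) = setWeight I A * setWeight J B := by
  have hAB : Disjoint A B := Finset.disjoint_of_subset_left hA
    (Finset.disjoint_of_subset_right hB hIJ)
  have h : (I ∪ J) \ (A ∪ B) = (I \ A) ∪ (J \ B) := by
    ext x
    have h1 := fun hx : x ∈ I => Finset.disjoint_left.1 hIJ hx
    have h2 := @hA x
    have h3 := @hB x
    simp only [Finset.mem_sdiff, Finset.mem_union]
    tauto
  have h' : Disjoint (I \ A) (J \ B) := Finset.disjoint_of_subset_left Finset.sdiff_subset
    (Finset.disjoint_of_subset_right Finset.sdiff_subset hIJ)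
  rw [setWeight, setWeight, setWeight, h, Finset.prod_union hAB, Finset.prod_union h']
  ring

lemma expect_union {I J : Finset ℕ} (hIJ : Disjoint I J) (f : Finset ℕ → ℝ) :
    expect (I ∪ J) f = expect I (fun A => expect J (fun B => f (A ∪ B))) := by
  simp only [expect, Finset.mul_sum]
  rw [← Finset.sum_product']
  refine (Finset.sum_bij' (fun T _ => T.1 ∪ T.2) (fun A _ => (A ∩ I, A ∩ J))
    ?_ ?_ ?_ ?_ ?_).symm
  · rintro ⟨A, B⟩ h
    simp only [Finset.mem_product, Finset.mem_powerset] at h ⊢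
    exact Finset.union_subset_union h.1 h.2
  · intro A _
    simp [Finset.inter_subset_right]
  · rintro ⟨A, B⟩ h
    simp only [Finset.mem_product, Finset.mem_powerset] at h
    have h1 := fun x (hx : x ∈ I) => Finset.disjoint_left.1 hIJ hx
    ext x
    · have h2 := @h.1 x
      have h3 := @h.2 x
      have := h1 x
      simp only [Finset.mem_inter, Finset.mem_union]
      tauto
    · have h2 := @h.1 x
      have h3 := @h.2 x
      have := h1 x
      simp only [Finset.mem_inter, Finset.mem_union]
      tauto
  · intro A h
    simp only [Finset.mem_powerset] at h
    rw [← Finset.inter_union_distrib_left, Finset.inter_eq_left.2 h]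
  · rintro ⟨A, B⟩ h
    simp only [Finset.mem_product, Finset.mem_powerset] at h
    simp only [setWeight_union hIJ h.1 h.2]
    ring

/-! ### Three independent random sets -/

/-- The expectation of `f` over three independent random subsets of `I`. -/
noncomputable def expect₃ (I : Finset ℕ) (f : Finset ℕ → Finset ℕ → Finset ℕ → ℝ) : ℝ :=
  expect I fun A => expect I fun B => expect I fun C => f A B C

lemma expect₃_mono {I : Finset ℕ} {f g : Finset ℕ → Finset ℕ → Finset ℕ → ℝ}
    (h : ∀ A ⊆ I, ∀ B ⊆ I, ∀ C ⊆ I, f A B C ≤ g A B C) : expect₃ I f ≤ expect₃ I g :=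
  expect_mono fun A hA => expect_mono fun B hB => expect_mono fun C hC => h A hA B hB C hC

lemma expect₃_const (I : Finset ℕ) (c : ℝ) : expect₃ I (fun _ _ _ => c) = c := by
  simp [expect₃, expect_const]

lemma expect₃_add (I : Finset ℕ) (f g : Finset ℕ → Finset ℕ → Finset ℕ → ℝ) :
    expect₃ I (fun A B C => f A B C + g A B C) = expect₃ I f + expect₃ I g := by
  simp [expect₃, expect_add]

lemma expect₃_const_mul (I : Finset ℕ) (c : ℝ) (f : Finset ℕ → Finset ℕ → Finset ℕ → ℝ) :
    expect₃ I (fun A B C => c * f A B C) = c * expect₃ I f := by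
  simp [expect₃, expect_const_mul]

lemma expect₃_mul_const (I : Finset ℕ) (c : ℝ) (f : Finset ℕ → Finset ℕ → Finset ℕ → ℝ) :
    expect₃ I (fun A B C => f A B C * c) = expect₃ I f * c := by
  simp [expect₃, expect_mul_const]

lemma expect₃_sum {ι : Type*} (s : Finset ι) (I : Finset ℕ)
    (f : ι → Finset ℕ → Finset ℕ → Finset ℕ → ℝ) :
    expect₃ I (fun A B C => ∑ i ∈ s, f i A B C) = ∑ i ∈ s, expect₃ I (f i) := by
  simp [expect₃, expect_sum]

lemma expect₃_mul (I : Finset ℕ) (f g h : Finset ℕ → ℝ) :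
    expect₃ I (fun A B C => f A * g B * h C) = expect I f * expect I g * expect I h := by
  simp [expect₃, expect_const_mul, expect_mul_const]

lemma expect₃_fst (I : Finset ℕ) (f : Finset ℕ → ℝ) :
    expect₃ I (fun A _ _ => f A) = expect I f := by
  simp [expect₃, expect_const]

lemma expect₃_snd (I : Finset ℕ) (f : Finset ℕ → ℝ) :
    expect₃ I (fun _ B _ => f B) = expect I f := by
  simp [expect₃, expect_const]

lemma expect₃_thd (I : Finset ℕ) (f : Finset ℕ → ℝ) :
    expect₃ I (fun _ _ C => f C) = expect I f := by
  simp [expect₃, expect_const]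

lemma expect₃_union {I J : Finset ℕ} (hIJ : Disjoint I J)
    (f : Finset ℕ → Finset ℕ → Finset ℕ → ℝ) :
    expect₃ (I ∪ J) f = expect₃ I fun A B C => expect₃ J fun A' B' C' =>
      f (A ∪ A') (B ∪ B') (C ∪ C') := by
  simp only [expect₃, expect_union hIJ]
  refine expect_congr fun A _ => ?_
  rw [expect_comm J I]
  refine expect_congr fun B _ => ?_
  simp only [expect_comm J I]

/-! ### Common subset sums and independence of disjoint blocks -/

/-- Nonempty subsets of `A`, `B`, `C` have a common sum. -/
def HasCommonSum (A B C : Finset ℕ) : Prop :=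
  ∃ a ⊆ A, ∃ b ⊆ B, ∃ c ⊆ C, a.Nonempty ∧ ∑ j ∈ a, j = ∑ j ∈ b, j ∧ ∑ j ∈ a, j = ∑ j ∈ c, j

lemma HasCommonSum.mono {A B C A' B' C' : Finset ℕ} (h : HasCommonSum A B C) (hA : A ⊆ A')
    (hB : B ⊆ B') (hC : C ⊆ C') : HasCommonSum A' B' C' := by
  obtain ⟨a, ha, b, hb, c, hc, h⟩ := h
  exact ⟨a, ha.trans hA, b, hb.trans hB, c, hc.trans hC, h⟩

open Classical in
/-- The probability that three independent random subsets of `I` have no common subset sum. -/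
noncomputable def missProb (I : Finset ℕ) : ℝ :=
  expect₃ I fun A B C => if HasCommonSum A B C then 0 else 1

lemma missProb_nonneg (I : Finset ℕ) : 0 ≤ missProb I := by
  classical
  rw [← expect₃_const I 0]
  refine expect₃_mono fun A _ B _ C _ => ?_
  split_ifs <;> norm_num

/-- A common sum in either part is one in the union, so a miss on the union is a miss on both parts,
and these are independent. -/
lemma missProb_union_le {I J : Finset ℕ} (hIJ : Disjoint I J) :
    missProb (I ∪ J) ≤ missProb I * missProb J := by
  classical
  rw [missProb, expect₃_union hIJ, missProb, ← expect₃_mul_const]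
  refine expect₃_mono fun A _ B _ C _ => ?_
  rw [missProb, ← expect₃_const_mul]
  refine expect₃_mono fun A' _ B' _ C' _ => ?_
  by_cases h : HasCommonSum A B C
  · rw [if_pos (h.mono Finset.subset_union_left Finset.subset_union_left
      Finset.subset_union_left), if_pos h]
    simp
  by_cases h' : HasCommonSum A' B' C'
  · rw [if_pos (h'.mono Finset.subset_union_right Finset.subset_union_right
      Finset.subset_union_right), if_pos h']
    simp
  rw [if_neg h, if_neg h']
  split_ifs <;> norm_num

/-- If every half-line contains a block on which `missProb` is at most `1 - c`, then it can be made
arbitrarily small on every half-line. -/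
lemma exists_missProb_le {c : ℝ}
    (h : ∀ k : ℕ, 0 < k → ∃ K, k < K ∧ missProb (Finset.Ioc k K) ≤ 1 - c) (k : ℕ) (hk : 0 < k)
    (n : ℕ) : ∃ K, k ≤ K ∧ missProb (Finset.Ioc k K) ≤ (1 - c) ^ n := by
  induction n with
  | zero =>
    refine ⟨k, le_rfl, ?_⟩
    rw [pow_zero, ← expect₃_const (Finset.Ioc k k) 1]
    classical
    refine expect₃_mono fun A _ B _ C _ => ?_
    split_ifs <;> norm_num
  | succ n ih =>
    obtain ⟨K, hkK, hK⟩ := ih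
    obtain ⟨K', hKK', hK'⟩ := h K (by omega)
    refine ⟨K', by omega, ?_⟩
    rw [← Finset.Ioc_union_Ioc_eq_Ioc hkK hKK'.le, pow_succ]
    refine (missProb_union_le ?_).trans
      (mul_le_mul hK hK' (missProb_nonneg _) ((missProb_nonneg _).trans hK))
    exact Finset.Ioc_disjoint_Ioc_of_le le_rfl

/-! ### Fourier analysis: counting pairs of differences -/

/-- The square of the modulus of the characteristic function, at the frequency `r / K`, of the sum
of a uniformly random subset of `A`. -/
noncomputable def cosProd (K : ℕ) (A : Finset ℕ) (r : ZMod K) : ℝ :=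
  ∏ j ∈ A, (1 + Real.cos (2 * Real.pi * (j * r.val / K))) / 2

/-- The sum over all frequencies of the products `cosProd` which belong to the pair of differences
of subset sums of `A`, `B` and `C`. -/
noncomputable def energy (K : ℕ) [NeZero K] (A B C : Finset ℕ) : ℝ :=
  ∑ r : ZMod K, ∑ s : ZMod K, cosProd K A r * cosProd K B s * cosProd K C (r + s)

lemma cosProd_nonneg {K : ℕ} (A : Finset ℕ) (r : ZMod K) : 0 ≤ cosProd K A r :=
  Finset.prod_nonneg fun j _ => by
    have := Real.neg_one_le_cos (2 * Real.pi * (j * r.val / K))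
    linarith

section Fourier

variable {K : ℕ} [NeZero K]

lemma re_stdAddChar_mul (r : ZMod K) (j : ℕ) :
    (ZMod.stdAddChar (r * (j : ZMod K))).re = Real.cos (2 * Real.pi * (j * r.val / K)) := by
  have h : r * (j : ZMod K) = (((j * r.val : ℕ) : ℤ) : ZMod K) := by
    push_cast
    rw [ZMod.natCast_zmod_val, mul_comm]
  rw [h, ZMod.stdAddChar_coe, ← Complex.exp_ofReal_mul_I_re]
  congr 2
  push_cast
  ring

lemma normSq_stdAddChar (r : ZMod K) : Complex.normSq (ZMod.stdAddChar r) = 1 := by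
  rw [Complex.normSq_eq_norm_sq, AddChar.norm_apply, one_pow]

lemma map_sum_stdAddChar (a : Finset ℕ) (f : ℕ → ZMod K) :
    ZMod.stdAddChar (∑ j ∈ a, f j) = ∏ j ∈ a, ZMod.stdAddChar (f j) := by
  classical
  induction a using Finset.induction_on with
  | empty => simp
  | insert j a hj ih => rw [Finset.sum_insert hj, Finset.prod_insert hj, AddChar.map_add_eq_mul, ih]

/-- The exponential sum over subsets factors over the elements, and `|1 + e^{iθ}|² = 2 + 2 cos θ`.
-/
lemma normSq_sum_stdAddChar (A : Finset ℕ) (r : ZMod K) :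
    Complex.normSq (∑ a ∈ A.powerset, ZMod.stdAddChar (r * ((∑ j ∈ a, j : ℕ) : ZMod K))) =
      4 ^ A.card * cosProd K A r := by
  have h : ∑ a ∈ A.powerset, ZMod.stdAddChar (r * ((∑ j ∈ a, j : ℕ) : ZMod K)) =
      ∏ j ∈ A, (1 + ZMod.stdAddChar (r * (j : ZMod K))) := by
    rw [Finset.prod_one_add]
    refine Finset.sum_congr rfl fun a _ => ?_
    rw [Nat.cast_sum, Finset.mul_sum]
    exact map_sum_stdAddChar a _
  rw [h, map_prod, cosProd, ← Finset.prod_const, ← Finset.prod_mul_distrib]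
  refine Finset.prod_congr rfl fun j _ => ?_
  rw [Complex.normSq_add, normSq_stdAddChar, Complex.normSq_one, one_mul, Complex.conj_re,
    re_stdAddChar_mul]
  ring

lemma normSq_sum_stdAddChar_neg (A : Finset ℕ) (r : ZMod K) :
    Complex.normSq (∑ a ∈ A.powerset, ZMod.stdAddChar (-(r * ((∑ j ∈ a, j : ℕ) : ZMod K)))) =
      4 ^ A.card * cosProd K A r := by
  rw [← normSq_sum_stdAddChar, ← Complex.normSq_conj, map_sum]
  congr 1
  refine Finset.sum_congr rfl fun a _ => ?_
  rw [AddChar.map_neg_eq_conj, Complex.conj_conj]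

-- Plancherel on `(ℤ/K)²`: expand the square and use orthogonality of characters, so that only
-- colliding pairs survive.
open Classical in
lemma sum_normSq_sum_stdAddChar {ι : Type*} (T : Finset ι) (g h : ι → ZMod K) :
    ∑ r : ZMod K, ∑ s : ZMod K, Complex.normSq
      (∑ t ∈ T, ZMod.stdAddChar (r * g t) * ZMod.stdAddChar (s * h t)) =
    (K : ℝ) ^ 2 * ((T ×ˢ T).filter fun t => (g t.1, h t.1) = (g t.2, h t.2)).card := by
  rw [← Complex.ofReal_inj]
  push_cast
  have key : ∀ r s : ZMod K, ((Complex.normSq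
      (∑ t ∈ T, ZMod.stdAddChar (r * g t) * ZMod.stdAddChar (s * h t)) : ℝ) : ℂ) =
      ∑ t ∈ T ×ˢ T, ZMod.stdAddChar (r * (g t.1 - g t.2)) *
        ZMod.stdAddChar (s * (h t.1 - h t.2)) := by
    intro r s
    rw [Complex.normSq_eq_conj_mul_self, mul_comm, map_sum, Finset.sum_mul_sum,
      Finset.sum_product]
    refine Finset.sum_congr rfl fun t _ => Finset.sum_congr rfl fun t' _ => ?_
    simp only [map_mul, ← AddChar.map_neg_eq_conj]
    rw [mul_sub, mul_sub, sub_eq_add_neg, sub_eq_add_neg, AddChar.map_add_eq_mul,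
      AddChar.map_add_eq_mul]
    ring
  simp only [key]
  have h2 : ∀ x y : ZMod K, ∑ r : ZMod K, ∑ s : ZMod K,
      ZMod.stdAddChar (r * x) * ZMod.stdAddChar (s * y) =
        if x = 0 ∧ y = 0 then (K : ℂ) ^ 2 else 0 := by
    intro x y
    simp only [← Finset.mul_sum, ← Finset.sum_mul]
    rw [AddChar.sum_mulShift _ (ZMod.isPrimitive_stdAddChar K),
      AddChar.sum_mulShift _ (ZMod.isPrimitive_stdAddChar K)]
    by_cases hx : x = 0 <;> by_cases hy : y = 0 <;> simp [hx, hy, ZMod.card, sq]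
  have h3 : ∀ r : ZMod K, ∑ s : ZMod K, ∑ t ∈ T ×ˢ T, ZMod.stdAddChar (r * (g t.1 - g t.2)) *
        ZMod.stdAddChar (s * (h t.1 - h t.2)) = ∑ t ∈ T ×ˢ T, ∑ s : ZMod K,
        ZMod.stdAddChar (r * (g t.1 - g t.2)) * ZMod.stdAddChar (s * (h t.1 - h t.2)) :=
    fun r => Finset.sum_comm
  simp only [h3]
  rw [Finset.sum_comm]
  simp only [h2, sub_eq_zero, ← Finset.sum_filter, Prod.mk.injEq]
  rw [Finset.sum_const, nsmul_eq_mul, mul_comm]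

/-- Cauchy–Schwarz applied to the sizes of the fibres of `g`. -/
lemma sq_card_le_card_image_mul {ι β : Type*} [DecidableEq β] (T : Finset ι) (g : ι → β) :
    T.card ^ 2 ≤ (T.image g).card * ((T ×ˢ T).filter fun t => g t.1 = g t.2).card := by
  have h1 : T.card = ∑ b ∈ T.image g, (T.filter fun t => g t = b).card :=
    Finset.card_eq_sum_card_image g T
  have h2 : ((T ×ˢ T).filter fun t => g t.1 = g t.2).card =
      ∑ b ∈ T.image g, (T.filter fun t => g t = b).card ^ 2 := by
    rw [Finset.card_eq_sum_card_fiberwise (f := fun t => g t.1) (t := T.image g)]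
    · refine Finset.sum_congr rfl fun b _ => ?_
      rw [sq, ← Finset.card_product]
      congr 1
      ext ⟨x, y⟩
      simp only [Finset.mem_filter, Finset.mem_product]
      constructor
      · rintro ⟨⟨⟨hx, hy⟩, h⟩, h'⟩
        exact ⟨⟨hx, h'⟩, hy, h ▸ h'⟩
      · rintro ⟨⟨hx, h⟩, hy, h'⟩
        exact ⟨⟨⟨hx, hy⟩, h.trans h'.symm⟩, h⟩
    · intro t ht
      have ht' := (Finset.mem_product.1 (Finset.mem_filter.1 ht).1).1
      exact Finset.mem_coe.2 (Finset.mem_image_of_mem g ht')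
  rw [h2, h1]
  exact sq_sum_le_card_mul_sum_sq

/-- The pairs of differences, modulo `K`, of subset sums of `A`, `B` and `C`. -/
def sumDiffs (K : ℕ) (A B C : Finset ℕ) : Finset (ZMod K × ZMod K) :=
  (A.powerset ×ˢ B.powerset ×ˢ C.powerset).image fun t =>
    (((∑ j ∈ t.1, j : ℕ) : ZMod K) - ((∑ j ∈ t.2.2, j : ℕ) : ZMod K),
      ((∑ j ∈ t.2.1, j : ℕ) : ZMod K) - ((∑ j ∈ t.2.2, j : ℕ) : ZMod K))

lemma sq_le_card_sumDiffs_mul_energy (A B C : Finset ℕ) :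
    (K : ℝ) ^ 2 ≤ (sumDiffs K A B C).card * energy K A B C := by
  classical
  set T := A.powerset ×ˢ B.powerset ×ˢ C.powerset with hT
  set u : Finset ℕ → ZMod K := fun a => ((∑ j ∈ a, j : ℕ) : ZMod K) with hu
  have hcard : (T.card : ℝ) ^ 2 = 4 ^ A.card * 4 ^ B.card * 4 ^ C.card := by
    rw [hT]
    simp only [Finset.card_product, Finset.card_powerset]
    push_cast
    rw [mul_pow, mul_pow, ← pow_mul, ← pow_mul, ← pow_mul, mul_comm _ 2, mul_comm _ 2,
      mul_comm _ 2, pow_mul, pow_mul, pow_mul]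
    norm_num
    ring
  have hpos : (0 : ℝ) < (T.card : ℝ) ^ 2 := by rw [hcard]; positivity
  have h1 := sum_normSq_sum_stdAddChar T (fun t => u t.1 - u t.2.2) (fun t => u t.2.1 - u t.2.2)
  have h2 : ∀ r s : ZMod K, Complex.normSq (∑ t ∈ T, ZMod.stdAddChar (r * (u t.1 - u t.2.2)) *
      ZMod.stdAddChar (s * (u t.2.1 - u t.2.2))) =
      (T.card : ℝ) ^ 2 * (cosProd K A r * cosProd K B s * cosProd K C (r + s)) := by
    intro r s
    -- The phase is `r(a - c) + s(b - c) = ra + sb - (r + s)c`, so the sum separates; this is the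
    -- origin of `r + s` in the energy.
    have : ∑ t ∈ T, ZMod.stdAddChar (r * (u t.1 - u t.2.2)) *
        ZMod.stdAddChar (s * (u t.2.1 - u t.2.2)) =
        (∑ a ∈ A.powerset, ZMod.stdAddChar (r * u a)) *
        ((∑ b ∈ B.powerset, ZMod.stdAddChar (s * u b)) *
        ∑ c ∈ C.powerset, ZMod.stdAddChar (-((r + s) * u c))) := by
      rw [hT, Finset.sum_mul_sum, Finset.sum_mul_sum, Finset.sum_product]
      refine Finset.sum_congr rfl fun a _ => ?_
      rw [Finset.sum_product]
      refine Finset.sum_congr rfl fun b _ => ?_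
      rw [Finset.mul_sum]
      refine Finset.sum_congr rfl fun c _ => ?_
      simp only [← AddChar.map_add_eq_mul]
      congr 1
      ring
    rw [this, map_mul, map_mul, normSq_sum_stdAddChar, normSq_sum_stdAddChar,
      normSq_sum_stdAddChar_neg, hcard]
    ring
  simp only [h2, ← Finset.mul_sum] at h1
  have h3 := sq_card_le_card_image_mul T (fun t => (u t.1 - u t.2.2, u t.2.1 - u t.2.2))
  have h3' : (T.card : ℝ) ^ 2 ≤ (sumDiffs K A B C).card * ((T ×ˢ T).filter fun t =>
      (u t.1.1 - u t.1.2.2, u t.1.2.1 - u t.1.2.2) =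
        (u t.2.1 - u t.2.2.2, u t.2.2.1 - u t.2.2.2)).card := by exact_mod_cast h3
  have h4 : (T.card : ℝ) ^ 2 * (K : ℝ) ^ 2 ≤
      (T.card : ℝ) ^ 2 * ((sumDiffs K A B C).card * energy K A B C) := by
    calc (T.card : ℝ) ^ 2 * (K : ℝ) ^ 2 ≤ _ := mul_le_mul_of_nonneg_right h3' (sq_nonneg _)
      _ = (sumDiffs K A B C).card * ((T.card : ℝ) ^ 2 * energy K A B C) := by
          rw [energy, h1]; ring
      _ = _ := by ring
  exact le_of_mul_le_mul_left h4 hpos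

end Fourier

/-! ### Exponential moments and typical sets -/

lemma expect_prod_le_exp (I : Finset ℕ) {u : ℕ → ℝ} (hu : ∀ j, 0 ≤ u j) :
    expect I (fun A => ∏ j ∈ A, u j) ≤ Real.exp (∑ j ∈ I, hitProb j * (u j - 1)) := by
  rw [expect_prod, Real.exp_sum]
  refine Finset.prod_le_prod (fun j _ => ?_) fun j _ => ?_
  · nlinarith [hu j, hitProb_nonneg j, hitProb_le_one j, mul_nonneg (hitProb_nonneg j) (hu j)]
  · linarith [Real.add_one_le_exp (hitProb j * (u j - 1))]

lemma filter_lt_Ioc {k L K : ℕ} (hkL : k ≤ L) :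
    (Finset.Ioc k K).filter (L < ·) = Finset.Ioc L K := by
  ext x
  simp only [Finset.mem_filter, Finset.mem_Ioc]
  omega

lemma prod_ite_filter {M : Type*} [CommMonoid M] (A : Finset ℕ) (L : ℕ) (f g : ℕ → M) :
    ∏ j ∈ A, (if L < j then f j * g j else f j) =
      (∏ j ∈ A, f j) * ∏ j ∈ A.filter (L < ·), g j := by
  rw [Finset.prod_filter, ← Finset.prod_mul_distrib]
  refine Finset.prod_congr rfl fun j _ => ?_
  split_ifs <;> simp

lemma log_sub_log_le_sum_hitProb {L K : ℕ} (hLK : L ≤ K) :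
    Real.log (K + 2) - Real.log (L + 2) ≤ ∑ j ∈ Finset.Ioc L K, hitProb j := by
  induction K, hLK using Nat.le_induction with
  | base => simp
  | succ n hn ih =>
    rw [Finset.sum_Ioc_succ_top (by omega)]
    have h1 := le_hitProb (j := n + 1) (by omega)
    have h2 : Real.log ((n : ℝ) + 1 + 2) - Real.log (n + 2) ≤ 1 / ((n : ℝ) + 1 + 1) := by
      rw [← Real.log_div (by positivity) (by positivity)]
      have := Real.log_le_sub_one_of_pos (x := ((n : ℝ) + 1 + 2) / (n + 2)) (by positivity)
      refine this.trans (le_of_eq ?_)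
      field_simp
      ring
    push_cast at h1 ⊢
    linarith

lemma mul_log_two_le_sum_hitProb {L : ℕ} (hL : 0 < L) (d : ℕ) :
    d * Real.log 2 - Real.log 3 ≤ ∑ j ∈ Finset.Ioc L (L * 2 ^ d), hitProb j := by
  refine le_trans ?_ (log_sub_log_le_sum_hitProb (Nat.le_mul_of_pos_right _ (by positivity)))
  rw [← Real.log_pow, ← Real.log_div (by positivity) (by positivity),
    ← Real.log_div (by positivity) (by positivity)]
  refine Real.log_le_log (by positivity) ?_
  rw [div_le_div_iff₀ (by positivity) (by positivity)]
  push_cast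
  have h1 : (1 : ℝ) ≤ L := by exact_mod_cast hL
  have h2 : (0 : ℝ) < 2 ^ d := by positivity
  nlinarith [mul_le_mul_of_nonneg_right h1 h2.le]

/-- On each block `(k * 2 ^ (m - d), k * 2 ^ m]`, the set `A` has at least `(17 / 25) * d - C`
elements. -/
def IsTypical (k m : ℕ) (C : ℝ) (A : Finset ℕ) : Prop :=
  ∀ d ≤ m, 17 / 25 * (d : ℝ) - C ≤ ((A.filter (k * 2 ^ (m - d) < ·)).card : ℝ)

lemma block_eq {k m d : ℕ} (hd : d ≤ m) : k * 2 ^ m = k * 2 ^ (m - d) * 2 ^ d := by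
  rw [mul_assoc, ← pow_add, Nat.sub_add_cancel hd]

-- Chernoff's bound with the weight `exp (-card / 100)`. The mean count is at least `d * log 2 - log
-- 3`, and `17 / 25 < log 2` leaves room for geometric decay in `d`.
open Classical in
lemma expect_card_lt_le {k m d : ℕ} (hk : 0 < k) (hd : d ≤ m) (C : ℝ) :
    expect (Finset.Ioc k (k * 2 ^ m)) (fun A =>
      if ((A.filter (k * 2 ^ (m - d) < ·)).card : ℝ) < 17 / 25 * (d : ℝ) - C then 1 else 0) ≤
    3 * Real.exp (-(C / 100)) * Real.exp (-(1 / 20000)) ^ d := by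
  set L := k * 2 ^ (m - d) with hL
  have hkL : k ≤ L := Nat.le_mul_of_pos_right _ (by positivity)
  have hL0 : 0 < L := by omega
  set q : ℝ := Real.exp (-(1 / 100)) with hq
  have hq0 : 0 < q := Real.exp_pos _
  have hq1 : q ≤ 100 / 101 := by
    rw [hq, Real.exp_neg]
    have := Real.add_one_le_exp (1 / 100 : ℝ)
    rw [inv_le_comm₀ (Real.exp_pos _) (by norm_num)]
    norm_num at this ⊢
    linarith
  have step1 : expect (Finset.Ioc k (k * 2 ^ m)) (fun A =>
      if ((A.filter (L < ·)).card : ℝ) < 17 / 25 * (d : ℝ) - C then 1 else 0) ≤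
      expect (Finset.Ioc k (k * 2 ^ m)) (fun A =>
        Real.exp ((17 / 25 * d - C) / 100) * ∏ j ∈ A, (if L < j then 1 * q else 1)) := by
    refine expect_mono fun A _ => ?_
    rw [prod_ite_filter, Finset.prod_const_one, Finset.prod_const, one_mul, hq, ← Real.exp_nat_mul,
      ← Real.exp_add]
    split_ifs with h
    · exact Real.one_le_exp (by linarith)
    · exact (Real.exp_pos _).le
  refine step1.trans ?_
  rw [expect_const_mul]
  have step2 := expect_prod_le_exp (Finset.Ioc k (k * 2 ^ m))
    (u := fun j => if L < j then 1 * q else 1) (fun j => by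
      split_ifs <;> linarith)
  have step3 : ∑ j ∈ Finset.Ioc k (k * 2 ^ m), hitProb j * ((if L < j then 1 * q else 1) - 1) =
      -((1 - q) * ∑ j ∈ Finset.Ioc L (L * 2 ^ d), hitProb j) := by
    rw [← block_eq hd, ← filter_lt_Ioc hkL, Finset.sum_filter, Finset.mul_sum,
      ← Finset.sum_neg_distrib]
    refine Finset.sum_congr rfl fun j _ => ?_
    split_ifs <;> ring
  rw [step3] at step2
  refine (mul_le_mul_of_nonneg_left step2 (Real.exp_pos _).le).trans ?_
  have h3 : (3 : ℝ) = Real.exp (Real.log 3) := (Real.exp_log (by norm_num)).symm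
  rw [h3, ← Real.exp_nat_mul, ← Real.exp_add, ← Real.exp_add, ← Real.exp_add, Real.exp_le_exp]
  have h4 := mul_log_two_le_sum_hitProb hL0 d
  have h5 : 0 ≤ Real.log 3 := Real.log_nonneg (by norm_num)
  have h6 := Real.log_two_gt_d9
  have h7 : (1 - q) * (d * Real.log 2 - Real.log 3) ≤
      (1 - q) * ∑ j ∈ Finset.Ioc L (L * 2 ^ d), hitProb j :=
    mul_le_mul_of_nonneg_left h4 (by linarith)
  have hd0 : (0 : ℝ) ≤ d := Nat.cast_nonneg d
  -- The numerical margin: `0.693147 / 101` exceeds `17 / 2500 + 1 / 20000`.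
  have h8 : 1 / 101 * (d * 0.693147) ≤ (1 - q) * (d * Real.log 2) := by
    refine mul_le_mul (by linarith) (mul_le_mul_of_nonneg_left (by linarith) hd0)
      (by positivity) (by linarith)
  have h9 : (1 - q) * Real.log 3 ≤ Real.log 3 := by nlinarith
  nlinarith

-- A union bound over `d`: the bounds form a geometric series, whose sum is made small uniformly in
-- `k` and `m` by taking `C` large.
open Classical in
lemma exists_expect_not_isTypical_le : ∃ C : ℝ, 0 ≤ C ∧ ∀ k m : ℕ, 0 < k →
    expect (Finset.Ioc k (k * 2 ^ m)) (fun A => if IsTypical k m C A then 0 else 1) ≤ 1 / 20 := by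
  set q : ℝ := Real.exp (-(1 / 20000)) with hq
  have hq0 : 0 ≤ q := (Real.exp_pos _).le
  have hq1 : q < 1 := by rw [hq, Real.exp_lt_one_iff]; norm_num
  have hlim : Filter.Tendsto (fun C : ℝ => 3 * Real.exp (-(C / 100)) * (1 - q)⁻¹) Filter.atTop
      (nhds (3 * 0 * (1 - q)⁻¹)) := by
    refine ((Real.tendsto_exp_neg_atTop_nhds_zero.comp ?_).const_mul 3).mul_const _
    exact Filter.tendsto_id.atTop_div_const (by norm_num)
  rw [mul_zero, zero_mul] at hlim
  obtain ⟨C, hC, hC0⟩ := ((hlim.eventually_le_const (show (0 : ℝ) < 1 / 20 by norm_num)).and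
    (Filter.eventually_ge_atTop 0)).exists
  refine ⟨C, hC0, fun k m hk => le_trans ?_ hC⟩
  have h1 : expect (Finset.Ioc k (k * 2 ^ m)) (fun A => if IsTypical k m C A then 0 else 1) ≤
      expect (Finset.Ioc k (k * 2 ^ m)) (fun A => ∑ d ∈ Finset.range (m + 1),
        if ((A.filter (k * 2 ^ (m - d) < ·)).card : ℝ) < 17 / 25 * (d : ℝ) - C
          then 1 else 0) := by
    refine expect_mono fun A _ => ?_
    have hnn : ∀ d ∈ Finset.range (m + 1), (0 : ℝ) ≤
        if ((A.filter (k * 2 ^ (m - d) < ·)).card : ℝ) < 17 / 25 * (d : ℝ) - C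
          then 1 else 0 := by
      intro d _
      split_ifs <;> norm_num
    split_ifs with h
    · exact Finset.sum_nonneg hnn
    · simp only [IsTypical, not_forall, not_le] at h
      obtain ⟨d, hd, h⟩ := h
      refine le_trans ?_ (Finset.single_le_sum hnn (Finset.mem_range.2 (Nat.lt_succ_of_le hd)))
      rw [if_pos h]
  refine h1.trans ?_
  rw [expect_sum]
  calc _ ≤ ∑ d ∈ Finset.range (m + 1), 3 * Real.exp (-(C / 100)) * q ^ d :=
        Finset.sum_le_sum fun d hd =>
          expect_card_lt_le hk (Nat.lt_succ_iff.1 (Finset.mem_range.1 hd)) C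
    _ = 3 * Real.exp (-(C / 100)) * ∑ d ∈ Finset.range (m + 1), q ^ d := by
        rw [Finset.mul_sum]
    _ ≤ _ := by
        refine mul_le_mul_of_nonneg_left ?_ (by positivity)
        rw [← tsum_geometric_of_lt_one hq0 hq1]
        exact (summable_geometric_of_lt_one hq0 hq1).sum_le_tsum _ fun d _ => by positivity

/-! ### Decay of the characteristic functions on typical sets -/

/-- Abel summation, kept one-sided: only `b ≤ 1` and the monotonicity of `p` beyond `L` enter. -/
lemma sum_mul_sub_le {p b : ℕ → ℝ} {L n : ℕ} (hLn : L ≤ n)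
    (hp : ∀ j, L < j → p (j + 1) ≤ p j) (hb : ∀ j, b j ≤ 1) :
    ∑ j ∈ Finset.Ioc L n, p j * (b (j + 1) - b j) ≤
      p (L + 1) * (1 - b (L + 1)) - p (n + 1) * (1 - b (n + 1)) := by
  induction n, hLn using Nat.le_induction with
  | base => simp
  | succ n hn ih =>
    rw [Finset.sum_Ioc_succ_top (by omega)]
    have := mul_le_mul_of_nonneg_right (hp (n + 1) (by omega)) (sub_nonneg.2 (hb (n + 2)))
    have e : n + 1 + 1 = n + 2 := rfl
    rw [e] at *
    linarith

lemma sum_hitProb_mul_cos_le {L n : ℕ} (hLn : L ≤ n) {θ : ℝ} (hθ : 0 < Real.sin (Real.pi * θ)) :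
    ∑ j ∈ Finset.Ioc L n, hitProb j * Real.cos (2 * Real.pi * (j * θ)) ≤
      1 / (L + 1) / Real.sin (Real.pi * θ) := by
  rw [le_div_iff₀ hθ]
  -- These sines telescope: consecutive ones differ by `2 cos (2πjθ) sin (πθ)`.
  have h := sum_mul_sub_le (p := hitProb) (b := fun j => Real.sin ((2 * j - 1) * (Real.pi * θ)))
    hLn (fun j hj => hitProb_anti (by omega) (by omega)) (fun j => Real.sin_le_one _)
  have h1 : ∀ j : ℕ, Real.sin ((2 * ((j + 1 : ℕ) : ℝ) - 1) * (Real.pi * θ)) -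
      Real.sin ((2 * j - 1) * (Real.pi * θ)) =
      2 * (Real.cos (2 * Real.pi * (j * θ)) * Real.sin (Real.pi * θ)) := by
    intro j
    rw [Real.sin_sub_sin]
    push_cast
    ring_nf
  simp only [h1] at h
  have h2 : ∑ j ∈ Finset.Ioc L n, hitProb j *
      (2 * (Real.cos (2 * Real.pi * (j * θ)) * Real.sin (Real.pi * θ))) =
      2 * ((∑ j ∈ Finset.Ioc L n, hitProb j * Real.cos (2 * Real.pi * (j * θ))) *
        Real.sin (Real.pi * θ)) := by
    rw [Finset.sum_mul, Finset.mul_sum]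
    exact Finset.sum_congr rfl fun j _ => by ring
  rw [h2] at h
  have h3 := hitProb_le (L + 1)
  have h4 := mul_nonneg (hitProb_nonneg (n + 1))
    (sub_nonneg.2 (Real.sin_le_one ((2 * ((n + 1 : ℕ) : ℝ) - 1) * (Real.pi * θ))))
  have h5 := mul_nonneg (hitProb_nonneg (L + 1)) (by
    linarith [Real.neg_one_le_sin ((2 * ((L + 1 : ℕ) : ℝ) - 1) * (Real.pi * θ))] :
      0 ≤ 1 + Real.sin ((2 * ((L + 1 : ℕ) : ℝ) - 1) * (Real.pi * θ)))
  push_cast at *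
  nlinarith

/-- Jordan's inequality, after reflecting `r` to `K - r` when `r > K / 2`. -/
lemma two_mul_div_le_sin {K r ρ : ℕ} (hK : 0 < K) (hr : ρ ≤ r) (hr' : ρ ≤ K - r) (hrK : r ≤ K) :
    2 * (ρ : ℝ) / K ≤ Real.sin (Real.pi * (r / K)) := by
  have hK' : (0 : ℝ) < K := by exact_mod_cast hK
  have hpi := Real.pi_pos
  have h1 : (ρ : ℝ) ≤ r := by exact_mod_cast hr
  have h2 : (ρ : ℝ) ≤ (K : ℝ) - r := by
    rw [← Nat.cast_sub hrK]
    exact_mod_cast hr'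
  have key : ∀ x : ℝ, (ρ : ℝ) ≤ x → x ≤ K / 2 → 2 * (ρ : ℝ) / K ≤ Real.sin (Real.pi * (x / K)) := by
    intro x hx hx'
    have hx0 : 0 ≤ x := (Nat.cast_nonneg _).trans hx
    have := Real.mul_le_sin (x := Real.pi * (x / K)) (by positivity) (by
      have : x / K ≤ 1 / 2 := by rw [div_le_iff₀ hK']; linarith
      nlinarith)
    refine le_trans ?_ this
    rw [← mul_assoc, div_mul_cancel₀ _ hpi.ne', mul_div_assoc]
    gcongr
  rcases le_total (r : ℝ) (K / 2) with h | h
  · exact key r h1 h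
  · have := key (K - r) h2 (by linarith)
    rw [sub_div, div_self hK'.ne', mul_sub, mul_one, Real.sin_pi_sub] at this
    exact this

-- Typicality pays for doubling every factor with `L < j`, at the price `2 ^ (C - 17 / 25 * d)`. A
-- doubled factor minus one is a pure cosine, so the exponent becomes an oscillating sum, at most
-- `(1 / L) / (2 / L) = 1 / 2` when `d > 0` and empty when `d = 0`. Factors with `j ≤ L` are at most
-- 1.
open Classical in
lemma expect_isTypical_mul_cosProd_le {k m d K : ℕ} (hk : 0 < k) (hK : K = k * 2 ^ m) (hd : d ≤ m) {C : ℝ}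
    (r : ZMod K)
    (hr : d = 0 ∨ 2 ^ d ≤ min r.val (K - r.val)) :
    expect (Finset.Ioc k K) (fun A =>
      (if IsTypical k m C A then 1 else 0) * cosProd K A r) ≤
    2 ^ C * Real.exp (1 / 2) * (2 : ℝ) ^ (-(17 / 25 * (d : ℝ))) := by
  have hK0 : 0 < K := by rw [hK]; positivity
  have : NeZero K := ⟨hK0.ne'⟩
  set L := k * 2 ^ (m - d) with hL
  have hkL : k ≤ L := Nat.le_mul_of_pos_right _ (by positivity)
  have hL0 : 0 < L := by omega
  have hKL : K = L * 2 ^ d := hK.trans (block_eq hd)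
  have hLK : L ≤ K := by rw [hKL]; exact Nat.le_mul_of_pos_right _ (by positivity)
  set v : ℕ → ℝ := fun j => (1 + Real.cos (2 * Real.pi * (j * r.val / K))) / 2 with hv
  have hv0 : ∀ j, 0 ≤ v j := fun j => by
    have := Real.neg_one_le_cos (2 * Real.pi * (j * r.val / K))
    simp only [hv]
    linarith
  have hv1 : ∀ j, v j ≤ 1 := fun j => by
    have := Real.cos_le_one (2 * Real.pi * (j * r.val / K))
    simp only [hv]
    linarith
  have step1 : expect (Finset.Ioc k K) (fun A =>
      (if IsTypical k m C A then 1 else 0) * cosProd K A r) ≤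
      expect (Finset.Ioc k K) (fun A => (2 : ℝ) ^ (C - 17 / 25 * (d : ℝ)) *
        ∏ j ∈ A, if L < j then v j * 2 else v j) := by
    refine expect_mono fun A _ => ?_
    rw [prod_ite_filter, Finset.prod_const]
    have h0 : 0 ≤ ∏ j ∈ A, v j := Finset.prod_nonneg fun j _ => hv0 j
    split_ifs with h
    · have h1 := h d hd
      have h2 : (1 : ℝ) ≤ (2 : ℝ) ^ (C - 17 / 25 * (d : ℝ)) *
          2 ^ (A.filter (L < ·)).card := by
        rw [← Real.rpow_natCast, ← Real.rpow_add (by norm_num)]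
        exact Real.one_le_rpow (by norm_num) (by linarith)
      rw [one_mul, cosProd]
      calc ∏ j ∈ A, v j = (∏ j ∈ A, v j) * 1 := (mul_one _).symm
        _ ≤ _ := mul_le_mul_of_nonneg_left h2 h0
        _ = _ := by ring
    · rw [zero_mul]
      positivity
  refine step1.trans ?_
  rw [expect_const_mul, sub_eq_add_neg, Real.rpow_add (by norm_num), mul_assoc, mul_assoc,
    mul_comm (Real.exp _)]
  refine mul_le_mul_of_nonneg_left (mul_le_mul_of_nonneg_left ?_ (by positivity)) (by positivity)
  refine (expect_prod_le_exp _ fun j => ?_).trans (Real.exp_le_exp.2 ?_)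
  · have := hv0 j
    split_ifs <;> positivity
  have step2 : ∑ j ∈ Finset.Ioc k K, hitProb j * ((if L < j then v j * 2 else v j) - 1) ≤
      ∑ j ∈ Finset.Ioc L K, hitProb j * Real.cos (2 * Real.pi * (j * (r.val / K))) := by
    rw [← filter_lt_Ioc hkL, Finset.sum_filter]
    refine Finset.sum_le_sum fun j _ => ?_
    split_ifs
    · refine le_of_eq ?_
      simp only [hv, mul_div_assoc]
      ring
    · exact mul_nonpos_of_nonneg_of_nonpos (hitProb_nonneg j) (by linarith [hv1 j])
  refine step2.trans ?_
  rcases Nat.eq_zero_or_pos d with hd0 | hd0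
  · have : L = K := by rw [hKL, hd0]; simp
    rw [this]
    simp
  · have hr' := hr.resolve_left hd0.ne'
    rw [le_min_iff] at hr'
    have hsin := two_mul_div_le_sin hK0 hr'.1 hr'.2 r.val_lt.le
    have hL' : (0 : ℝ) < L := by exact_mod_cast hL0
    have h2 : 2 * ((2 ^ d : ℕ) : ℝ) / K = 2 / L := by
      rw [hKL]
      push_cast
      field_simp
    rw [h2] at hsin
    have hpos : 0 < Real.sin (Real.pi * (r.val / K)) := lt_of_lt_of_le (by positivity) hsin
    refine (sum_hitProb_mul_cos_le hLK hpos).trans ?_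
    rw [div_le_iff₀ hpos]
    have h3 : (1 : ℝ) / (L + 1) ≤ 1 / L := one_div_le_one_div_of_le hL' (by linarith)
    have h4 : (1 : ℝ) / L = 1 / 2 * (2 / L) := by ring
    linarith

/-! ### Boundedness of the expected energy -/

/-- The number of dyadic blocks at the top of `(k, K]`, where `K = k * 2 ^ m`, on which the
frequency `r / K` oscillates. -/
def oscDepth (K m : ℕ) (r : ZMod K) : ℕ := min m (Nat.log 2 (min r.val (K - r.val)))

lemma oscDepth_spec (K m : ℕ) (r : ZMod K) :
    oscDepth K m r = 0 ∨ 2 ^ oscDepth K m r ≤ min r.val (K - r.val) := by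
  by_cases h : min r.val (K - r.val) = 0
  · left
    simp [oscDepth, h]
  · right
    exact (Nat.pow_le_pow_right (by norm_num) (min_le_right _ _)).trans (Nat.pow_log_le_self 2 h)

lemma sum_zmod_val {M : Type*} [AddCommMonoid M] (K : ℕ) [NeZero K] (g : ℕ → M) :
    ∑ r : ZMod K, g r.val = ∑ n ∈ Finset.range K, g n :=
  Finset.sum_bij' (fun r _ => r.val) (fun n _ => n)
    (fun r _ => Finset.mem_range.2 r.val_lt) (fun _ _ => Finset.mem_univ _)
    (fun r _ => ZMod.natCast_zmod_val r)
    (fun _ hn => ZMod.val_cast_of_lt (Finset.mem_range.1 hn)) (fun _ _ => rfl)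

lemma rpow_two_neg_log_le (n : ℕ) :
    (2 : ℝ) ^ (-(51 / 50 * (Nat.log 2 n : ℝ))) ≤ 4 * ((n : ℝ) + 1) ^ (-(51 / 50) : ℝ) := by
  have h : n + 1 ≤ 2 ^ Nat.log 2 n * 2 := by
    have := Nat.lt_pow_succ_log_self (b := 2) (by norm_num) n
    rw [pow_succ] at this
    omega
  have h1 : ((n : ℝ) + 1) / 2 ≤ 2 ^ (Nat.log 2 n : ℝ) := by
    rw [Real.rpow_natCast, div_le_iff₀ (by norm_num)]
    exact_mod_cast h
  have h2 : (2 : ℝ) ^ (-(51 / 50 * (Nat.log 2 n : ℝ))) =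
      ((2 : ℝ) ^ (Nat.log 2 n : ℝ)) ^ (-(51 / 50) : ℝ) := by
    rw [← Real.rpow_mul (by norm_num)]
    congr 1
    ring
  rw [h2]
  refine (Real.rpow_le_rpow_of_nonpos (by positivity) h1 (by norm_num)).trans ?_
  rw [Real.div_rpow (by positivity) (by norm_num), div_eq_mul_inv, mul_comm]
  refine mul_le_mul_of_nonneg_right ?_ (by positivity)
  rw [← Real.rpow_neg (by norm_num), neg_neg]
  have : (2 : ℝ) ^ (51 / 50 : ℝ) ≤ 2 ^ (2 : ℝ) :=
    Real.rpow_le_rpow_of_exponent_le (by norm_num) (by norm_num)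
  norm_num at this ⊢
  linarith

/-- Uncapped depths give terms of order `min(r, K - r) ^ (-51 / 50)`, which are summable. Capped
depths contribute at most `K * 2 ^ (-51 * k) = k * 2 ^ (-k) ≤ 1`, which explains the choice of `50 *
k` blocks. -/
lemma exists_sum_rpow_oscDepth_le : ∃ Q : ℝ, 0 ≤ Q ∧ ∀ k K : ℕ, ∀ [NeZero K],
    K = k * 2 ^ (50 * k) →
    ∑ r : ZMod K, (2 : ℝ) ^ (-(51 / 50 * (oscDepth K (50 * k) r : ℝ))) ≤ Q := by
  set f : ℕ → ℝ := fun n => ((n : ℝ) + 1) ^ (-(51 / 50) : ℝ) with hf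
  have hf0 : ∀ n, 0 ≤ f n := fun n => by simp only [hf]; positivity
  have hsum : Summable f := by
    have := (summable_nat_add_iff 1).2
      (Real.summable_nat_rpow (p := (-(51 / 50) : ℝ)).2 (by norm_num))
    simpa [hf] using this
  have htsum : 0 ≤ ∑' n, f n := tsum_nonneg hf0
  refine ⟨1 + 4 * (∑' n, f n + ∑' n, f n), by positivity, fun k K _ hK => ?_⟩
  have hpt : ∀ r : ZMod K, (2 : ℝ) ^ (-(51 / 50 * (oscDepth K (50 * k) r : ℝ))) ≤
      2 ^ (-(51 / 50 * ((50 * k : ℕ) : ℝ))) + 4 * (f r.val + f (K - r.val)) := by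
    intro r
    have h4 : (0 : ℝ) ≤ 2 ^ (-(51 / 50 * ((50 * k : ℕ) : ℝ))) := by positivity
    have h5 := hf0 r.val
    have h6 := hf0 (K - r.val)
    rcases le_total (50 * k) (Nat.log 2 (min r.val (K - r.val))) with h | h
    · rw [oscDepth, min_eq_left h]
      linarith
    · rw [oscDepth, min_eq_right h]
      have h7 := rpow_two_neg_log_le (min r.val (K - r.val))
      rcases le_total r.val (K - r.val) with h' | h'
      · rw [min_eq_left h'] at h7 ⊢
        simp only [hf] at *
        linarith
      · rw [min_eq_right h'] at h7 ⊢
        simp only [hf] at *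
        linarith
  refine (Finset.sum_le_sum fun r _ => hpt r).trans ?_
  rw [Finset.sum_add_distrib, ← Finset.mul_sum, Finset.sum_add_distrib,
    sum_zmod_val K f, sum_zmod_val K fun n => f (K - n)]
  have h1 : ∑ _r : ZMod K, (2 : ℝ) ^ (-(51 / 50 * ((50 * k : ℕ) : ℝ))) ≤ 1 := by
    rw [Finset.sum_const, Finset.card_univ, ZMod.card, nsmul_eq_mul, hK]
    have e : -(51 / 50 * ((50 * k : ℕ) : ℝ)) = -((50 * k : ℕ) : ℝ) + -(k : ℝ) := by
      push_cast
      ring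
    rw [e, Real.rpow_add (by norm_num), Real.rpow_neg (by norm_num), Real.rpow_neg (by norm_num),
      Real.rpow_natCast, Real.rpow_natCast]
    have h2 : (k : ℝ) ≤ 2 ^ k := by exact_mod_cast Nat.lt_two_pow_self.le
    push_cast
    rw [mul_assoc, ← mul_assoc ((2 : ℝ) ^ (50 * k)), mul_inv_cancel₀ (by positivity), one_mul,
      ← div_eq_mul_inv, div_le_one (by positivity)]
    exact h2
  have h2 : ∑ n ∈ Finset.range K, f n ≤ ∑' n, f n := hsum.sum_le_tsum _ fun n _ => hf0 n
  have h3 : ∑ n ∈ Finset.range K, f (K - n) ≤ ∑ n ∈ Finset.range K, f n := by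
    rw [← Finset.sum_range_reflect f]
    refine Finset.sum_le_sum fun n hn => ?_
    have hn := Finset.mem_range.1 hn
    simp only [hf]
    refine Real.rpow_le_rpow_of_nonpos (by positivity) ?_ (by norm_num)
    have : K - 1 - n ≤ K - n := by omega
    have : ((K - 1 - n : ℕ) : ℝ) ≤ ((K - n : ℕ) : ℝ) := by exact_mod_cast this
    linarith
  linarith

lemma sq_mul_sq_mul_sq_le {x y z : ℝ} (hx : 0 ≤ x) (hy : 0 ≤ y) (hz : 0 ≤ z) :
    x ^ 2 * y ^ 2 * z ^ 2 ≤ 1 / 3 * (x ^ 3 * y ^ 3 + y ^ 3 * z ^ 3 + x ^ 3 * z ^ 3) := by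
  have key : ∀ a b c : ℝ, 0 ≤ a → 0 ≤ b → 0 ≤ c → a * b * c ≤ 1 / 3 * (a ^ 3 + b ^ 3 + c ^ 3) := by
    intro a b c ha hb hc
    nlinarith [mul_nonneg (add_nonneg (add_nonneg ha hb) hc) (add_nonneg (add_nonneg
      (sq_nonneg (a - b)) (sq_nonneg (b - c))) (sq_nonneg (a - c)))]
  have := key (x * y) (y * z) (x * z) (by positivity) (by positivity) (by positivity)
  calc x ^ 2 * y ^ 2 * z ^ 2 = x * y * (y * z) * (x * z) := by ring
    _ ≤ _ := this
    _ = _ := by ring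

/-- AM–GM replaces the three factors by two cubes, after which each double sum separates by
translation invariance. -/
lemma sum_sum_sq_mul_le {G : Type*} [AddCommGroup G] [Fintype G] {φ : G → ℝ} (hφ : ∀ r, 0 ≤ φ r) :
    ∑ r, ∑ s, φ r ^ 2 * φ s ^ 2 * φ (r + s) ^ 2 ≤ (∑ r, φ r ^ 3) ^ 2 := by
  have h1 : ∑ r, ∑ s, φ r ^ 3 * φ s ^ 3 = (∑ r, φ r ^ 3) ^ 2 := by
    rw [sq, Finset.sum_mul_sum]
  have h2 : ∑ r, ∑ s, φ r ^ 3 * φ (r + s) ^ 3 = (∑ r, φ r ^ 3) ^ 2 := by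
    rw [sq, Finset.sum_mul]
    refine Finset.sum_congr rfl fun r _ => ?_
    rw [← Finset.mul_sum]
    exact congrArg _ (Equiv.sum_comp (Equiv.addLeft r) fun s => φ s ^ 3)
  have h3 : ∑ r, ∑ s, φ s ^ 3 * φ (r + s) ^ 3 = (∑ r, φ r ^ 3) ^ 2 := by
    rw [Finset.sum_comm, sq, Finset.sum_mul]
    refine Finset.sum_congr rfl fun s _ => ?_
    rw [← Finset.mul_sum]
    exact congrArg _ (Equiv.sum_comp (Equiv.addRight s) fun r => φ r ^ 3)
  calc ∑ r, ∑ s, φ r ^ 2 * φ s ^ 2 * φ (r + s) ^ 2 ≤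
      ∑ r, ∑ s, 1 / 3 * (φ r ^ 3 * φ s ^ 3 + φ s ^ 3 * φ (r + s) ^ 3 + φ r ^ 3 * φ (r + s) ^ 3) :=
        Finset.sum_le_sum fun r _ => Finset.sum_le_sum fun s _ =>
          sq_mul_sq_mul_sq_le (hφ r) (hφ s) (hφ _)
    _ = (∑ r, φ r ^ 3) ^ 2 := by
        have h4 : ∀ f g h : G → G → ℝ, ∑ r, ∑ s, 1 / 3 * (f r s + g r s + h r s) =
            1 / 3 * (∑ r, ∑ s, f r s + ∑ r, ∑ s, g r s + ∑ r, ∑ s, h r s) := by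
          intro f g h
          simp only [← Finset.mul_sum, Finset.sum_add_distrib]
        rw [h4, h1, h2, h3]
        ring

open Classical in
/-- The indicator function of `IsTypical`. -/
noncomputable def typInd (k m : ℕ) (C : ℝ) (A : Finset ℕ) : ℝ := if IsTypical k m C A then 1 else 0

/-- Independence factors each term's expectation at `r`, `s`, `r + s`. Writing the decay `2 ^ (-17 /
25 * d)` as `φ ^ 2`, the double sum is controlled by `∑ φ ^ 3`, whose exponent `51 / 50` exceeds 1.
-/
lemma exists_expect_energy_le (C : ℝ) : ∃ Q : ℝ, 0 ≤ Q ∧ ∀ k K : ℕ, ∀ [NeZero K], 0 < k →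
    K = k * 2 ^ (50 * k) →
    expect₃ (Finset.Ioc k K) (fun A B D => typInd k (50 * k) C A * typInd k (50 * k) C B *
      typInd k (50 * k) C D * energy K A B D) ≤ Q := by
  obtain ⟨Q, hQ0, hQ⟩ := exists_sum_rpow_oscDepth_le
  set c : ℝ := 2 ^ C * Real.exp (1 / 2) with hc
  have hc0 : 0 ≤ c := by positivity
  refine ⟨c ^ 3 * Q ^ 2, by positivity, fun k K _ hk hK => ?_⟩
  set φ : ZMod K → ℝ := fun r => 2 ^ (-(17 / 50 * (oscDepth K (50 * k) r : ℝ))) with hφ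
  have hφ0 : ∀ r, 0 ≤ φ r := fun r => by simp only [hφ]; positivity
  set e : ZMod K → ℝ := fun r =>
    expect (Finset.Ioc k K) fun A => typInd k (50 * k) C A * cosProd K A r with he
  have he0 : ∀ r, 0 ≤ e r := fun r => expect_nonneg fun A _ =>
    mul_nonneg (by simp only [typInd]; split_ifs <;> norm_num) (cosProd_nonneg A r)
  have hφ2 : ∀ r, φ r ^ 2 = 2 ^ (-(17 / 25 * (oscDepth K (50 * k) r : ℝ))) := by
    intro r
    rw [← Real.rpow_natCast, ← Real.rpow_mul (by norm_num)]
    congr 1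
    push_cast
    ring
  have hφ3 : ∀ r, φ r ^ 3 = 2 ^ (-(51 / 50 * (oscDepth K (50 * k) r : ℝ))) := by
    intro r
    rw [← Real.rpow_natCast, ← Real.rpow_mul (by norm_num)]
    congr 1
    push_cast
    ring
  have hele : ∀ r, e r ≤ c * φ r ^ 2 := by
    intro r
    rw [hφ2]
    exact expect_isTypical_mul_cosProd_le hk hK (min_le_left _ _) r (oscDepth_spec K _ r)
  have h1 : expect₃ (Finset.Ioc k K) (fun A B D => typInd k (50 * k) C A * typInd k (50 * k) C B *
      typInd k (50 * k) C D * energy K A B D) = ∑ r, ∑ s, e r * e s * e (r + s) := by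
    have h2 : ∀ A B D, typInd k (50 * k) C A * typInd k (50 * k) C B *
        typInd k (50 * k) C D * energy K A B D = ∑ r : ZMod K, ∑ s : ZMod K,
        (typInd k (50 * k) C A * cosProd K A r) * (typInd k (50 * k) C B * cosProd K B s) *
          (typInd k (50 * k) C D * cosProd K D (r + s)) := by
      intro A B D
      rw [energy, Finset.mul_sum]
      refine Finset.sum_congr rfl fun r _ => ?_
      rw [Finset.mul_sum]
      exact Finset.sum_congr rfl fun s _ => by ring
    simp only [h2, expect₃_sum]
    exact Finset.sum_congr rfl fun r _ => Finset.sum_congr rfl fun s _ => expect₃_mul _ _ _ _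
  rw [h1]
  calc ∑ r, ∑ s, e r * e s * e (r + s) ≤
      ∑ r, ∑ s, c ^ 3 * (φ r ^ 2 * φ s ^ 2 * φ (r + s) ^ 2) := by
        refine Finset.sum_le_sum fun r _ => Finset.sum_le_sum fun s _ => ?_
        calc e r * e s * e (r + s) ≤ (c * φ r ^ 2) * (c * φ s ^ 2) * (c * φ (r + s) ^ 2) :=
              mul_le_mul (mul_le_mul (hele r) (hele s) (he0 s) (by positivity)) (hele _) (he0 _)
                (by positivity)
          _ = _ := by ring
    _ = c ^ 3 * ∑ r, ∑ s, φ r ^ 2 * φ s ^ 2 * φ (r + s) ^ 2 := by simp only [Finset.mul_sum]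
    _ ≤ c ^ 3 * (∑ r, φ r ^ 3) ^ 2 :=
        mul_le_mul_of_nonneg_left (sum_sum_sq_mul_le hφ0) (by positivity)
    _ ≤ c ^ 3 * Q ^ 2 := by
        refine mul_le_mul_of_nonneg_left (pow_le_pow_left₀ ?_ ?_ 2) (by positivity)
        · exact Finset.sum_nonneg fun r _ => by have := hφ0 r; positivity
        · simp only [hφ3]
          exact hQ k K hK

/-! ### Small sums and small energy hold together with probability at least 1/2 -/

lemma expect_sum_id_le (k K : ℕ) :
    expect (Finset.Ioc k K) (fun A => ((∑ j ∈ A, j : ℕ) : ℝ)) ≤ K := by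
  have h1 : expect (Finset.Ioc k K) (fun A => ((∑ j ∈ A, j : ℕ) : ℝ)) =
      expect (Finset.Ioc k K) (fun A => ∑ j ∈ Finset.Ioc k K, (j : ℝ) * if j ∈ A then 1 else 0) := by
    refine expect_congr fun A hA => ?_
    simp only [mul_ite, mul_one, mul_zero]
    rw [← Finset.sum_filter, Finset.filter_mem_eq_inter, Finset.inter_eq_right.2 hA, Nat.cast_sum]
  have h2 : ∀ j ∈ Finset.Ioc k K,
      expect (Finset.Ioc k K) (fun A => if j ∈ A then 1 else 0) = hitProb j := by
    intro j hj
    have h3 := expect_prod (Finset.Ioc k K) fun i => if i = j then 0 else 1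
    have h4 : expect (Finset.Ioc k K) (fun A => if j ∈ A then 1 else 0) =
        expect (Finset.Ioc k K) (fun A => 1 + (-1) * ∏ i ∈ A, if i = j then 0 else 1) := by
      refine expect_congr fun A _ => ?_
      by_cases h : j ∈ A
      · rw [if_pos h, Finset.prod_eq_zero h (by simp)]
        ring
      · rw [if_neg h, Finset.prod_eq_one fun i hi => if_neg (ne_of_mem_of_not_mem hi h)]
        ring
    rw [h4, expect_add, expect_const, expect_const_mul, h3, Finset.prod_eq_single_of_mem j hj]
    · simp
    · intro i _ hi
      simp [hi]
  rw [h1, expect_sum]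
  calc _ = ∑ j ∈ Finset.Ioc k K, (j : ℝ) * hitProb j := by
        refine Finset.sum_congr rfl fun j hj => ?_
        rw [expect_const_mul, h2 j hj]
    _ ≤ ∑ j ∈ Finset.Ioc k K, (1 : ℝ) := by
        refine Finset.sum_le_sum fun j hj => ?_
        have hj0 : (0 : ℝ) < j := by
          have := (Finset.mem_Ioc.1 hj).1
          exact_mod_cast (by omega : 0 < j)
        have := mul_le_mul_of_nonneg_left (hitProb_le j) hj0.le
        rwa [mul_one_div_cancel hj0.ne'] at this
    _ ≤ K := by
        rw [Finset.sum_const, Nat.card_Ioc, nsmul_eq_mul, mul_one]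
        exact_mod_cast Nat.sub_le K k

/-- The sums of `A`, `B`, `C` are at most `20 * K`, and their energy is at most `Q`. -/
def IsSpread (K : ℕ) [NeZero K] (Q : ℝ) (A B C : Finset ℕ) : Prop :=
  ∑ j ∈ A, j ≤ 20 * K ∧ ∑ j ∈ B, j ≤ 20 * K ∧ ∑ j ∈ C, j ≤ 20 * K ∧ energy K A B C ≤ Q

lemma energy_nonneg {K : ℕ} [NeZero K] (A B C : Finset ℕ) : 0 ≤ energy K A B C :=
  Finset.sum_nonneg fun _ _ => Finset.sum_nonneg fun _ _ =>
    mul_nonneg (mul_nonneg (cosProd_nonneg _ _) (cosProd_nonneg _ _)) (cosProd_nonneg _ _)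

open Classical in
lemma exists_expect_not_isSpread_le : ∃ Q : ℝ, 0 < Q ∧ ∀ k K : ℕ, ∀ [NeZero K], 0 < k →
    K = k * 2 ^ (50 * k) →
    expect₃ (Finset.Ioc k K) (fun A B C => if IsSpread K Q A B C then 0 else 1) ≤ 1 / 2 := by
  obtain ⟨C, -, hC⟩ := exists_expect_not_isTypical_le
  obtain ⟨R, hR0, hR⟩ := exists_expect_energy_le C
  -- Markov's inequality: each set fails with probability at most `1 / 20 + 1 / 20`, and the energy
  -- exceeds this bound on typical triples with probability at most `1 / 20`; the total is `7 / 20`.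
  refine ⟨20 * R + 20, by positivity, fun k K _ hk hK => ?_⟩
  have hK0 : (0 : ℝ) < K := by exact_mod_cast Nat.pos_of_ne_zero (NeZero.ne K)
  set Q := 20 * R + 20 with hQ
  have hQ0 : 0 < Q := by positivity
  set m := 50 * k with hm
  set I := Finset.Ioc k K with hI
  set g : Finset ℕ → ℝ := fun A =>
    (if IsTypical k m C A then 0 else 1) + 1 / (20 * K) * ((∑ j ∈ A, j : ℕ) : ℝ) with hg
  have hg1 : expect I g ≤ 1 / 10 := by
    rw [hg, expect_add, expect_const_mul]
    have h1 := hC k m hk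
    rw [← hK] at h1
    have h2 := mul_le_mul_of_nonneg_left (expect_sum_id_le k K)
      (by positivity : (0 : ℝ) ≤ 1 / (20 * K))
    have h3 : 1 / (20 * (K : ℝ)) * K = 1 / 20 := by field_simp
    rw [h3] at h2
    linarith
  have hg0 : ∀ A, 0 ≤ g A := by
    intro A
    have : (0 : ℝ) ≤ 1 / (20 * K) * ((∑ j ∈ A, j : ℕ) : ℝ) := by positivity
    simp only [hg]
    split_ifs <;> linarith
  have hgT : ∀ A, ¬ IsTypical k m C A → 1 ≤ g A := by
    intro A hA
    have : (0 : ℝ) ≤ 1 / (20 * K) * ((∑ j ∈ A, j : ℕ) : ℝ) := by positivity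
    simp only [hg, if_neg hA]
    linarith
  have hgS : ∀ A : Finset ℕ, ¬ (∑ j ∈ A, j ≤ 20 * K) → 1 ≤ g A := by
    intro A hA
    have h1 : (20 * K : ℝ) ≤ ((∑ j ∈ A, j : ℕ) : ℝ) := by exact_mod_cast (not_le.1 hA).le
    have h2 : 1 ≤ 1 / (20 * (K : ℝ)) * ((∑ j ∈ A, j : ℕ) : ℝ) := by
      rw [one_div_mul_eq_div, le_div_iff₀ (by positivity), one_mul]
      exact h1
    simp only [hg]
    split_ifs <;> linarith
  set t : Finset ℕ → Finset ℕ → Finset ℕ → ℝ := fun A B D =>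
    typInd k m C A * typInd k m C B * typInd k m C D * energy K A B D with ht
  have ht0 : ∀ A B D, 0 ≤ t A B D := by
    intro A B D
    have h : ∀ A, 0 ≤ typInd k m C A := fun A => by
      simp only [typInd]; split_ifs <;> norm_num
    exact mul_nonneg (mul_nonneg (mul_nonneg (h A) (h B)) (h D)) (energy_nonneg _ _ _)
  have hle : expect₃ I (fun A B D => if IsSpread K Q A B D then 0 else 1) ≤
      expect₃ I (fun A B D => ((g A + g B) + g D) + 1 / Q * t A B D) := by
    refine expect₃_mono fun A _ B _ D _ => ?_
    have hA := hg0 A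
    have hB := hg0 B
    have hD := hg0 D
    have h0 : 0 ≤ 1 / Q * t A B D := mul_nonneg (by positivity) (ht0 A B D)
    split_ifs with h
    · positivity
    by_cases h1 : IsTypical k m C A ∧ ∑ j ∈ A, j ≤ 20 * K
    swap
    · have : 1 ≤ g A := by
        by_cases h' : IsTypical k m C A
        · exact hgS A fun h'' => h1 ⟨h', h''⟩
        · exact hgT A h'
      linarith
    by_cases h2 : IsTypical k m C B ∧ ∑ j ∈ B, j ≤ 20 * K
    swap
    · have : 1 ≤ g B := by
        by_cases h' : IsTypical k m C B
        · exact hgS B fun h'' => h2 ⟨h', h''⟩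
        · exact hgT B h'
      linarith
    by_cases h3 : IsTypical k m C D ∧ ∑ j ∈ D, j ≤ 20 * K
    swap
    · have : 1 ≤ g D := by
        by_cases h' : IsTypical k m C D
        · exact hgS D fun h'' => h3 ⟨h', h''⟩
        · exact hgT D h'
      linarith
    have h4 : Q < energy K A B D := by
      by_contra h'
      exact h ⟨h1.2, h2.2, h3.2, not_lt.1 h'⟩
    have h5 : t A B D = energy K A B D := by
      simp only [ht, typInd, if_pos h1.1, if_pos h2.1, if_pos h3.1]
      ring
    have h6 : 1 ≤ 1 / Q * t A B D := by
      rw [h5, one_div_mul_eq_div, le_div_iff₀ hQ0, one_mul]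
      exact h4.le
    linarith
  refine hle.trans ?_
  rw [expect₃_add, expect₃_add, expect₃_add, expect₃_fst, expect₃_snd, expect₃_thd,
    expect₃_const_mul]
  have h7 : 1 / Q * expect₃ I t ≤ 1 / 20 := by
    rw [one_div_mul_eq_div, div_le_iff₀ hQ0]
    have := hR k K hk hK
    linarith
  linarith

/-! ### Completing differences to a common sum -/

lemma le_setWeight_singleton {K j : ℕ} (hK : 0 < K) (hj : j ∈ Finset.Ioc K (61 * K)) :
    Real.exp (-60) / (62 * K) ≤ setWeight (Finset.Ioc K (61 * K)) {j} := by
  have hK' : (1 : ℝ) ≤ K := by exact_mod_cast hK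
  have hj' := Finset.mem_Ioc.1 hj
  have h1 : 1 / (62 * (K : ℝ)) ≤ hitProb j := by
    refine le_trans ?_ (le_hitProb (by omega))
    refine one_div_le_one_div_of_le (by positivity) ?_
    have : (j : ℝ) ≤ 61 * K := by exact_mod_cast hj'.2
    linarith
  have h2 : Real.exp (-60) ≤ ∏ i ∈ Finset.Ioc K (61 * K) \ {j}, (1 - hitProb i) := by
    simp only [one_sub_hitProb]
    rw [← Real.exp_sum, Real.exp_le_exp, Finset.sum_neg_distrib, neg_le_neg_iff]
    calc ∑ i ∈ Finset.Ioc K (61 * K) \ {j}, 1 / (i : ℝ)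
        ≤ ∑ i ∈ Finset.Ioc K (61 * K), 1 / (i : ℝ) :=
          Finset.sum_le_sum_of_subset_of_nonneg Finset.sdiff_subset fun i _ _ => by positivity
      _ ≤ ∑ i ∈ Finset.Ioc K (61 * K), 1 / (K : ℝ) := by
          refine Finset.sum_le_sum fun i hi => one_div_le_one_div_of_le (by positivity) ?_
          exact_mod_cast (Finset.mem_Ioc.1 hi).1.le
      _ = 60 := by
          rw [Finset.sum_const, Nat.card_Ioc, nsmul_eq_mul,
            show 61 * K - K = 60 * K by omega]
          push_cast
          field_simp
  rw [setWeight, Finset.prod_singleton, div_eq_mul_one_div, mul_comm]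
  exact mul_le_mul h1 h2 (Real.exp_pos _).le (hitProb_nonneg j)

lemma mul_sum_singleton_le_expect {J : Finset ℕ} {c : ℝ} (hc : ∀ j ∈ J, c ≤ setWeight J {j})
    {f : Finset ℕ → ℝ} (hf : ∀ A, 0 ≤ f A) : c * ∑ j ∈ J, f {j} ≤ expect J f := by
  calc c * ∑ j ∈ J, f {j} = ∑ j ∈ J, c * f {j} := Finset.mul_sum _ _ _
    _ ≤ ∑ j ∈ J, setWeight J {j} * f {j} :=
        Finset.sum_le_sum fun j hj => mul_le_mul_of_nonneg_right (hc j hj) (hf _)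
    _ = ∑ A ∈ J.image (fun j => {j}), setWeight J A * f A :=
        (Finset.sum_image (g := fun j => ({j} : Finset ℕ)) (f := fun A => setWeight J A * f A)
          fun i _ j _ h => Finset.singleton_injective h).symm
    _ ≤ expect J f := by
        refine Finset.sum_le_sum_of_subset_of_nonneg ?_ fun A _ _ =>
          mul_nonneg (setWeight_nonneg _ _) (hf A)
        intro A hA
        obtain ⟨j, hj, rfl⟩ := Finset.mem_image.1 hA
        exact Finset.mem_powerset.2 (Finset.singleton_subset_iff.2 hj)

lemma mul_sum_singleton_le_expect₃ {J : Finset ℕ} {c : ℝ} (hc0 : 0 ≤ c)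
    (hc : ∀ j ∈ J, c ≤ setWeight J {j}) {f : Finset ℕ → Finset ℕ → Finset ℕ → ℝ}
    (hf : ∀ A B C, 0 ≤ f A B C) :
    c ^ 3 * ∑ t ∈ J ×ˢ J ×ˢ J, f {t.1} {t.2.1} {t.2.2} ≤ expect₃ J f := by
  have h1 : ∀ A B, c * ∑ l ∈ J, f A B {l} ≤ expect J fun C => f A B C := fun A B =>
    mul_sum_singleton_le_expect hc (hf A B)
  have h2 : ∀ A, c * ∑ i ∈ J, c * ∑ l ∈ J, f A {i} {l} ≤
      expect J fun B => expect J fun C => f A B C := fun A =>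
    (mul_le_mul_of_nonneg_left (Finset.sum_le_sum fun i _ => h1 A {i}) hc0).trans
      (mul_sum_singleton_le_expect hc fun B => expect_nonneg fun C _ => hf A B C)
  have h3 : c * ∑ j ∈ J, c * ∑ i ∈ J, c * ∑ l ∈ J, f {j} {i} {l} ≤ expect₃ J f :=
    (mul_le_mul_of_nonneg_left (Finset.sum_le_sum fun j _ => h2 {j}) hc0).trans
      (mul_sum_singleton_le_expect hc fun A => expect_nonneg fun B _ =>
        expect_nonneg fun C _ => hf A B C)
  refine le_trans (le_of_eq ?_) h3
  simp only [Finset.sum_product, ← Finset.mul_sum]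
  ring

open Classical in
/-- The triples which, added to `A`, `B` and `C`, produce a common subset sum. -/
noncomputable def completions (K : ℕ) (A B C : Finset ℕ) : Finset (ℕ × ℕ × ℕ) :=
  (Finset.Ioc K (61 * K) ×ˢ Finset.Ioc K (61 * K) ×ˢ Finset.Ioc K (61 * K)).filter fun t =>
    HasCommonSum (A ∪ {t.1}) (B ∪ {t.2.1}) (C ∪ {t.2.2})

/-- Given subset sums `a`, `b`, `c` and `n ∈ (21 * K, 41 * K]`, put `x = c + n - a` and `y = c + n -
b`. Since `a, b, c ≤ 20 * K`, both lie in `(K, 61 * K]`, hence are new elements, and adding `x`,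
`y`, `n` equalises the sums. The triple determines `n` and, modulo `K`, both differences `n - x` and
`n - y`, so distinct data yield distinct triples. -/
lemma card_sumDiffs_mul_le {k K : ℕ} {A B C : Finset ℕ} (hA : A ⊆ Finset.Ioc k K)
    (hB : B ⊆ Finset.Ioc k K) (hC : C ⊆ Finset.Ioc k K) (hA' : ∑ j ∈ A, j ≤ 20 * K)
    (hB' : ∑ j ∈ B, j ≤ 20 * K) (hC' : ∑ j ∈ C, j ≤ 20 * K) :
    (sumDiffs K A B C).card * (20 * K) ≤ (completions K A B C).card := by
  have hcard : (sumDiffs K A B C ×ˢ Finset.Ioc (21 * K) (41 * K)).card =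
      (sumDiffs K A B C).card * (20 * K) := by
    rw [Finset.card_product, Nat.card_Ioc]
    congr 1
    omega
  rw [← hcard]
  refine Finset.card_le_card_of_surjOn (fun t => (((t.2.2 : ZMod K) - t.1,
    (t.2.2 : ZMod K) - t.2.1), t.2.2)) ?_
  rintro ⟨s, n⟩ hs
  have hs' := Finset.mem_product.1 (Finset.mem_coe.1 hs)
  obtain ⟨h1, hn⟩ := hs'
  obtain ⟨⟨a, b, c⟩, habc, rfl⟩ := Finset.mem_image.1 h1
  simp only [Finset.mem_product, Finset.mem_powerset] at habc
  obtain ⟨ha, hb, hc⟩ := habc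
  have hn := Finset.mem_Ioc.1 hn
  simp only at hn
  have hsa := (Finset.sum_le_sum_of_subset (f := fun j : ℕ => j) ha).trans hA'
  have hsb := (Finset.sum_le_sum_of_subset (f := fun j : ℕ => j) hb).trans hB'
  have hsc := (Finset.sum_le_sum_of_subset (f := fun j : ℕ => j) hc).trans hC'
  have hnot : ∀ {a : Finset ℕ} {x : ℕ}, a ⊆ Finset.Ioc k K → K < x → x ∉ a := by
    intro a x h hx hxa
    have := (Finset.mem_Ioc.1 (h hxa)).2
    omega
  obtain ⟨x, hx⟩ : ∃ x, ∑ j ∈ a, j + x = ∑ j ∈ c, j + n :=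
    ⟨∑ j ∈ c, j + n - ∑ j ∈ a, j, by omega⟩
  obtain ⟨y, hy⟩ : ∃ y, ∑ j ∈ b, j + y = ∑ j ∈ c, j + n :=
    ⟨∑ j ∈ c, j + n - ∑ j ∈ b, j, by omega⟩
  refine ⟨(x, y, n), ?_, ?_⟩
  · simp only [completions, Finset.coe_filter, Finset.mem_product, Finset.mem_Ioc,
      Set.mem_ofPred_eq]
    refine ⟨⟨⟨by omega, by omega⟩, ⟨by omega, by omega⟩, ⟨by omega, by omega⟩⟩,
      a ∪ {x}, Finset.union_subset_union_left ha, b ∪ {y}, Finset.union_subset_union_left hb,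
      c ∪ {n}, Finset.union_subset_union_left hc, ⟨x, by simp⟩, ?_, ?_⟩
    all_goals
      rw [Finset.sum_union (Finset.disjoint_singleton_right.2 (hnot (ha.trans hA) (by omega))),
        Finset.sum_union (Finset.disjoint_singleton_right.2 (hnot (by
          first | exact hb.trans hB | exact hc.trans hC) (by omega))),
        Finset.sum_singleton, Finset.sum_singleton]
      omega
  · have hx' := congrArg (Nat.cast : ℕ → ZMod K) hx
    have hy' := congrArg (Nat.cast : ℕ → ZMod K) hy
    rw [Nat.cast_add, Nat.cast_add] at hx' hy'
    simp only [Prod.mk.injEq, and_true]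
    exact ⟨by linear_combination -hx', by linear_combination -hy'⟩

open Classical in
lemma expect₃_not_hasCommonSum_union_le {k K : ℕ} [NeZero K] {Q : ℝ} (hQ : 0 < Q)
    {A B C : Finset ℕ} (hA : A ⊆ Finset.Ioc k K)
    (hB : B ⊆ Finset.Ioc k K) (hC : C ⊆ Finset.Ioc k K) (h : IsSpread K Q A B C) :
    expect₃ (Finset.Ioc K (61 * K)) (fun A' B' C' =>
      if HasCommonSum (A ∪ A') (B ∪ B') (C ∪ C') then 0 else 1) ≤
    1 - 20 * (Real.exp (-60) / 62) ^ 3 / Q := by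
  have hK := Nat.pos_of_ne_zero (NeZero.ne K)
  have hK' : (0 : ℝ) < K := by exact_mod_cast hK
  have h1 : expect₃ (Finset.Ioc K (61 * K)) (fun A' B' C' =>
      if HasCommonSum (A ∪ A') (B ∪ B') (C ∪ C') then 0 else 1) =
      1 + (-1) * expect₃ (Finset.Ioc K (61 * K)) (fun A' B' C' =>
      if HasCommonSum (A ∪ A') (B ∪ B') (C ∪ C') then 1 else 0) := by
    rw [← expect₃_const_mul, ← expect₃_const (Finset.Ioc K (61 * K)) 1, ← expect₃_add]
    congr 1
    funext A' B' C'
    split_ifs <;> simp [expect₃_const]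
  have h2 := mul_sum_singleton_le_expect₃ (J := Finset.Ioc K (61 * K))
    (by positivity : (0 : ℝ) ≤ Real.exp (-60) / (62 * K))
    (fun j hj => le_setWeight_singleton hK hj)
    (f := fun A' B' C' => if HasCommonSum (A ∪ A') (B ∪ B') (C ∪ C') then 1 else 0)
    (fun _ _ _ => by split_ifs <;> norm_num)
  rw [← Finset.sum_filter, Finset.sum_const, nsmul_eq_mul, mul_one] at h2
  change _ * ((completions K A B C).card : ℝ) ≤ _ at h2
  have h3 : ((sumDiffs K A B C).card : ℝ) * (20 * K) ≤ (completions K A B C).card := by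
    exact_mod_cast card_sumDiffs_mul_le hA hB hC h.1 h.2.1 h.2.2.1
  have h4 : (K : ℝ) ^ 2 ≤ (sumDiffs K A B C).card * Q :=
    (sq_le_card_sumDiffs_mul_energy A B C).trans
      (mul_le_mul_of_nonneg_left h.2.2.2 (Nat.cast_nonneg _))
  have h5 : 20 * (Real.exp (-60) / 62) ^ 3 / Q ≤
      (Real.exp (-60) / (62 * K)) ^ 3 * (completions K A B C).card := by
    calc 20 * (Real.exp (-60) / 62) ^ 3 / Q =
        (Real.exp (-60) / (62 * K)) ^ 3 * (K ^ 2 / Q * (20 * K)) := by field_simp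
      _ ≤ (Real.exp (-60) / (62 * K)) ^ 3 * ((sumDiffs K A B C).card * (20 * K)) := by
          gcongr
          rw [div_le_iff₀ hQ]
          exact h4
      _ ≤ _ := by gcongr
  rw [h1]
  linarith

theorem exists_missProb_Ioc_le : ∃ c : ℝ, 0 < c ∧ c ≤ 1 ∧ ∀ k : ℕ, 0 < k →
    ∃ K, k < K ∧ missProb (Finset.Ioc k K) ≤ 1 - c := by
  classical
  obtain ⟨Q, hQ0, hQ⟩ := exists_expect_not_isSpread_le
  set c := 20 * (Real.exp (-60) / 62) ^ 3 / Q with hc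
  have hc0 : 0 < c := by positivity
  -- The factor 1/2 is the probability of spread triples; the minimum with 1 keeps `1 - c`
  -- nonnegative for the limit of its powers.
  refine ⟨min 1 (c / 2), by positivity, min_le_left _ _, fun k hk => ?_⟩
  obtain ⟨K, hK⟩ : ∃ K, K = k * 2 ^ (50 * k) := ⟨_, rfl⟩
  have hkK : k ≤ K := hK ▸ Nat.le_mul_of_pos_right _ (by positivity)
  have : NeZero K := ⟨by omega⟩
  refine ⟨61 * K, by omega, ?_⟩
  rw [← Finset.Ioc_union_Ioc_eq_Ioc hkK (by omega : K ≤ 61 * K), missProb,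
    expect₃_union (Finset.Ioc_disjoint_Ioc_of_le le_rfl)]
  have h1 : expect₃ (Finset.Ioc k K) (fun A B C => expect₃ (Finset.Ioc K (61 * K)) fun A' B' C' =>
      if HasCommonSum (A ∪ A') (B ∪ B') (C ∪ C') then 0 else 1) ≤
      expect₃ (Finset.Ioc k K) (fun A B C =>
        (1 - c) + c * if IsSpread K Q A B C then 0 else 1) := by
    refine expect₃_mono fun A hA B hB C hC => ?_
    by_cases h : IsSpread K Q A B C
    · rw [if_pos h, mul_zero, add_zero]
      exact expect₃_not_hasCommonSum_union_le hQ0 hA hB hC h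
    · rw [if_neg h, mul_one, sub_add_cancel]
      refine (expect₃_mono fun A' _ B' _ C' _ => ?_).trans_eq (expect₃_const _ 1)
      split_ifs <;> norm_num
  refine h1.trans ?_
  rw [expect₃_add, expect₃_const, expect₃_const_mul]
  have h2 := mul_le_mul_of_nonneg_left (hQ k K hk hK) hc0.le
  have h3 := min_le_right 1 (c / 2)
  linarith

/-! ### From finite random sets to Poisson sequences -/

/-- The indices `j ∈ I` at which `W` does not vanish. -/
def hitSet (I : Finset ℕ) (W : ℕ+ → ℕ) : Finset ℕ := I.filter fun j => W j.toPNat' ≠ 0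

lemma hitSet_subset (I : Finset ℕ) (W : ℕ+ → ℕ) : hitSet I W ⊆ I := Finset.filter_subset _ _

lemma measurableSet_hitSet_eq (I A : Finset ℕ) :
    MeasurableSet {W : ℕ+ → ℕ | hitSet I W = A} := by
  have h : {W : ℕ+ → ℕ | hitSet I W = A} =
      ⋂ j : ℕ, {W | (j ∈ I ∧ W j.toPNat' ≠ 0) ↔ j ∈ A} := by
    ext W
    simp [hitSet, Finset.ext_iff]
  rw [h]
  refine MeasurableSet.iInter fun j => ?_
  have : {W : ℕ+ → ℕ | (j ∈ I ∧ W j.toPNat' ≠ 0) ↔ j ∈ A} =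
      (fun W : ℕ+ → ℕ => W j.toPNat') ⁻¹' {n | (j ∈ I ∧ n ≠ 0) ↔ j ∈ A} := rfl
  rw [this]
  exact measurable_pi_apply _ (MeasurableSet.of_discrete)

/-- Positivity is essential, since `Nat.toPNat'` sends both 0 and 1 to 1. -/
lemma toPNat'_injOn {I : Finset ℕ} (hI : ∀ j ∈ I, 0 < j) :
    Set.InjOn Nat.toPNat' (I : Set ℕ) := by
  intro i hi j hj hij
  have := congrArg PNat.val hij
  have h1 := hI i hi
  have h2 := hI j hj
  simpa [h1, h2] using this

section Law

variable {Ω : Type*} [MeasurableSpace Ω] {μ : Measure Ω}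

lemma IsPoissonSeq.measure_eq_zero {X : ℕ+ → Ω → ℕ} (hX : IsPoissonSeq X μ) (j : ℕ+) :
    μ (X j ⁻¹' {0}) = ENNReal.ofReal (1 - hitProb j) := by
  rw [← Measure.map_apply_of_aemeasurable (hX.hasLaw j).aemeasurable (MeasurableSet.of_discrete),
    (hX.hasLaw j).map_eq, one_sub_hitProb]
  simp [poissonMeasure_singleton]

lemma IsPoissonSeq.measure_ne_zero {X : ℕ+ → Ω → ℕ} [IsProbabilityMeasure μ]
    (hX : IsPoissonSeq X μ) (j : ℕ+) :
    μ (X j ⁻¹' {0}ᶜ) = ENNReal.ofReal (hitProb j) := by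
  have h := hX.measure_eq_zero j
  rw [← Measure.map_apply_of_aemeasurable (hX.hasLaw j).aemeasurable
    (MeasurableSet.of_discrete)] at h ⊢
  have : IsProbabilityMeasure (μ.map (X j)) :=
    Measure.isProbabilityMeasure_map (hX.hasLaw j).aemeasurable
  rw [prob_compl_eq_one_sub MeasurableSet.of_discrete, h, ← ENNReal.ofReal_one,
    ← ENNReal.ofReal_sub _ (sub_nonneg.2 (hitProb_le_one _))]
  simp

lemma IsPoissonSeq.measure_hitSet_eq [IsProbabilityMeasure μ] {X : ℕ+ → Ω → ℕ}
    (hX : IsPoissonSeq X μ) {I A : Finset ℕ} (hI : ∀ j ∈ I, 0 < j) (hA : A ⊆ I) :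
    μ {ω | hitSet I (fun j => X j ω) = A} = ENNReal.ofReal (setWeight I A) := by
  classical
  let s : ℕ+ → Set ℕ := fun j => if (j : ℕ) ∈ A then {0}ᶜ else {0}
  have h : {ω | hitSet I (fun j => X j ω) = A} =
      ⋂ j ∈ I.image Nat.toPNat', X j ⁻¹' s j := by
    ext ω
    simp only [Set.mem_ofPred_eq, hitSet, Finset.ext_iff, Finset.mem_filter, Finset.mem_image,
      Set.mem_iInter, Set.mem_preimage, s, forall_exists_index, and_imp,
      forall_apply_eq_imp_iff₂]
    refine forall_congr' fun j => ?_
    by_cases hj : j ∈ I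
    · have hj0 := hI j hj
      by_cases hjA : j ∈ A <;> simp [hj, hjA, hj0]
    · have hjA : j ∉ A := fun h => hj (hA h)
      simp [hj, hjA]
  rw [h, hX.indep.measure_inter_preimage_eq_mul _ (fun _ _ => MeasurableSet.of_discrete),
    Finset.prod_image (toPNat'_injOn hI)]
  have h2 : ∀ j ∈ I, μ (X j.toPNat' ⁻¹' s j.toPNat') =
      ENNReal.ofReal (if j ∈ A then hitProb j else 1 - hitProb j) := by
    intro j hj
    have hj0 := hI j hj
    by_cases hjA : j ∈ A
    · have h0 := hX.measure_ne_zero j.toPNat'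
      simp only [Nat.toPNat'_coe, hj0, if_true] at h0
      simp only [s, Nat.toPNat'_coe, hj0, if_true, hjA, h0]
    · simp [s, hjA, hj0, hX.measure_eq_zero]
  rw [Finset.prod_congr rfl h2, ← ENNReal.ofReal_prod_of_nonneg, Finset.prod_ite, setWeight]
  · congr 3
    · rw [Finset.filter_mem_eq_inter, Finset.inter_eq_right.2 hA]
    · rw [Finset.filter_notMem_eq_sdiff]
  · intro j _
    split_ifs
    · exact hitProb_nonneg j
    · exact sub_nonneg.2 (hitProb_le_one j)

lemma measure_hitSet_eq₃ [IsProbabilityMeasure μ] {X Y Z : ℕ+ → Ω → ℕ}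
    (hX : IsPoissonSeq X μ) (hY : IsPoissonSeq Y μ) (hZ : IsPoissonSeq Z μ)
    (hXYZ : iIndepFun (![fun ω j => X j ω, fun ω j => Y j ω, fun ω j => Z j ω] :
      Fin 3 → Ω → ℕ+ → ℕ) μ)
    {I A B C : Finset ℕ} (hI : ∀ j ∈ I, 0 < j) (hA : A ⊆ I) (hB : B ⊆ I) (hC : C ⊆ I) :
    μ {ω | hitSet I (fun j => X j ω) = A ∧ hitSet I (fun j => Y j ω) = B ∧
        hitSet I (fun j => Z j ω) = C} =
      ENNReal.ofReal (setWeight I A * (setWeight I B * setWeight I C)) := by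
  have h := hXYZ.measure_inter_preimage_eq_mul Finset.univ
    (sets := ![{W | hitSet I W = A}, {W | hitSet I W = B}, {W | hitSet I W = C}]) (by
      intro i _
      fin_cases i <;> exact measurableSet_hitSet_eq _ _)
  rw [ENNReal.ofReal_mul (setWeight_nonneg _ _), ENNReal.ofReal_mul (setWeight_nonneg _ _),
    ← hX.measure_hitSet_eq hI hA, ← hY.measure_hitSet_eq hI hB, ← hZ.measure_hitSet_eq hI hC]
  simp only [Fin.prod_univ_three] at h
  rw [← mul_assoc]
  refine Eq.trans (congrArg μ ?_) h
  ext ω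
  simp [Fin.forall_fin_succ]

/-- The event is covered by finitely many outcomes of the three hit sets, whose probabilities add up
to `missProb I`. -/
lemma measure_not_hasCommonSum_le [IsProbabilityMeasure μ] {X Y Z : ℕ+ → Ω → ℕ}
    (hX : IsPoissonSeq X μ) (hY : IsPoissonSeq Y μ) (hZ : IsPoissonSeq Z μ)
    (hXYZ : iIndepFun (![fun ω j => X j ω, fun ω j => Y j ω, fun ω j => Z j ω] :
      Fin 3 → Ω → ℕ+ → ℕ) μ) {I : Finset ℕ} (hI : ∀ j ∈ I, 0 < j) :
    μ {ω | ¬ HasCommonSum (hitSet I fun j => X j ω) (hitSet I fun j => Y j ω)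
      (hitSet I fun j => Z j ω)} ≤ ENNReal.ofReal (missProb I) := by
  classical
  let P := I.powerset
  let T := (P ×ˢ P ×ˢ P).filter fun t => ¬ HasCommonSum t.1 t.2.1 t.2.2
  have hsub : {ω | ¬ HasCommonSum (hitSet I fun j => X j ω) (hitSet I fun j => Y j ω)
      (hitSet I fun j => Z j ω)} ⊆ ⋃ t ∈ T, {ω | hitSet I (fun j => X j ω) = t.1 ∧
        hitSet I (fun j => Y j ω) = t.2.1 ∧ hitSet I (fun j => Z j ω) = t.2.2} := by
    intro ω hω
    simp only [Set.mem_iUnion]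
    exact ⟨(hitSet I fun j => X j ω, hitSet I fun j => Y j ω, hitSet I fun j => Z j ω),
      by simpa [T, P, hitSet_subset] using hω, rfl, rfl, rfl⟩
  refine (measure_mono hsub).trans ((measure_biUnion_finset_le _ _).trans (le_of_eq ?_))
  have h1 : ∀ t ∈ T, μ {ω | hitSet I (fun j => X j ω) = t.1 ∧
        hitSet I (fun j => Y j ω) = t.2.1 ∧ hitSet I (fun j => Z j ω) = t.2.2} =
      ENNReal.ofReal (setWeight I t.1 * (setWeight I t.2.1 * setWeight I t.2.2)) := by
    intro t ht
    simp only [T, P, Finset.mem_filter, Finset.mem_product, Finset.mem_powerset] at ht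
    exact measure_hitSet_eq₃ hX hY hZ hXYZ hI ht.1.1 ht.1.2.1 ht.1.2.2
  rw [Finset.sum_congr rfl h1, ← ENNReal.ofReal_sum_of_nonneg (fun t _ =>
    mul_nonneg (setWeight_nonneg _ _) (mul_nonneg (setWeight_nonneg _ _) (setWeight_nonneg _ _)))]
  congr 1
  rw [Finset.sum_filter, Finset.sum_product, missProb, expect₃, expect]
  refine Finset.sum_congr rfl fun A _ => ?_
  rw [Finset.sum_product, expect, Finset.mul_sum]
  refine Finset.sum_congr rfl fun B _ => ?_
  rw [expect, Finset.mul_sum, Finset.mul_sum]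
  refine Finset.sum_congr rfl fun C _ => ?_
  by_cases h : HasCommonSum A B C <;> simp [h]

end Law

lemma sum_mem_sumsetL {W : ℕ+ → ℕ} {I a : Finset ℕ} (hI : ∀ j ∈ I, 0 < j) (ha : a ⊆ hitSet I W) :
    ∑ j ∈ a, j ∈ sumsetL W := by
  classical
  have ha0 : ∀ j ∈ a, 0 < j := fun j hj => hI j (hitSet_subset I W (ha hj))
  refine ⟨Finsupp.indicator (a.image Nat.toPNat') fun _ _ => 1, fun j => ?_, ?_⟩
  · by_cases hj : j ∈ a.image Nat.toPNat'
    · rw [Finsupp.indicator_of_mem hj]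
      obtain ⟨i, hi, rfl⟩ := Finset.mem_image.1 hj
      have := (Finset.mem_filter.1 (ha hi)).2
      omega
    · rw [Finsupp.indicator_of_notMem hj]
      exact Nat.zero_le _
  · rw [Finsupp.sum_of_support_subset _ (Finsupp.support_indicator_subset _ _) _ (by simp),
      Finset.sum_image (toPNat'_injOn ha0)]
    refine Finset.sum_congr rfl fun j hj => ?_
    rw [Finsupp.indicator_of_mem (Finset.mem_image_of_mem _ hj)]
    simp [ha0 j hj]

theorem corollary3p7 {Ω : Type*} [MeasurableSpace Ω] (μ : Measure Ω) [IsProbabilityMeasure μ]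
    (X Y Z : ℕ+ → Ω → ℕ)
    (hX : IsPoissonSeq X μ) (hY : IsPoissonSeq Y μ) (hZ : IsPoissonSeq Z μ)
    (hXYZ : iIndepFun (![fun ω j => X j ω, fun ω j => Y j ω, fun ω j => Z j ω] :
      Fin 3 → Ω → ℕ+ → ℕ) μ) :
    ∀ᵐ ω ∂μ, (sumsetL (fun j => X j ω) ∩ sumsetL (fun j => Y j ω) ∩
      sumsetL (fun j => Z j ω)).Infinite := by
  obtain ⟨c, hc, hc1, hmiss⟩ := exists_missProb_Ioc_le
  have hpos : ∀ k K : ℕ, ∀ j ∈ Finset.Ioc k K, 0 < j := fun k K j hj => by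
    have := (Finset.mem_Ioc.1 hj).1
    omega
  have key : ∀ k : ℕ, ∀ᵐ ω ∂μ, ∃ K, HasCommonSum (hitSet (Finset.Ioc (k + 1) K) fun j => X j ω)
      (hitSet (Finset.Ioc (k + 1) K) fun j => Y j ω)
      (hitSet (Finset.Ioc (k + 1) K) fun j => Z j ω) := by
    intro k
    rw [ae_iff]
    have hlim : Filter.Tendsto (fun n : ℕ => ENNReal.ofReal ((1 - c) ^ n)) Filter.atTop
        (nhds 0) := by
      rw [← ENNReal.ofReal_zero]
      exact ENNReal.tendsto_ofReal (tendsto_pow_atTop_nhds_zero_of_lt_one (by linarith)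
        (by linarith))
    refine le_antisymm (ge_of_tendsto' hlim fun n => ?_) zero_le
    -- Starting at `k + 1` gives the block the positive left endpoint required by
    -- `exists_missProb_le`, also when `k = 0`.
    obtain ⟨K, -, hK⟩ := exists_missProb_le hmiss (k + 1) k.succ_pos n
    refine (measure_mono fun ω hω => ?_).trans
      ((measure_not_hasCommonSum_le hX hY hZ hXYZ (hpos (k + 1) K)).trans
        (ENNReal.ofReal_le_ofReal hK))
    simp only [Set.mem_ofPred_eq, not_exists] at hω
    exact hω K
  filter_upwards [ae_all_iff.2 key] with ω hω
  refine Set.infinite_of_forall_exists_gt fun k => ?_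
  obtain ⟨K, a, ha, b, hb, d, hd, ⟨i, hi⟩, hab, had⟩ := hω k
  refine ⟨∑ j ∈ a, j, ⟨⟨sum_mem_sumsetL (hpos _ _) ha, ?_⟩, ?_⟩, ?_⟩
  · rw [hab]
    exact sum_mem_sumsetL (hpos _ _) hb
  · rw [had]
    exact sum_mem_sumsetL (hpos _ _) hd
  · have h1 := (Finset.mem_Ioc.1 (hitSet_subset _ _ (ha hi))).1
    have h2 := Finset.single_le_sum (f := id) (fun _ _ => Nat.zero_le _) hi
    simp only [id] at h2
    omega
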